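/- Let $d\ge 1$ be an integer, $\beta\ge 0$ and $h\in\mathbb R$. For $n\ge 1$ let $\varepsilon=(\varepsilon_1,\dots,\varepsilon_n)$ be the spins of the Curie-Weiss model, that is, the random vector in $\{-1,1\}^n$ with $$P(\varepsilon=\sigma)=\frac{1}{Z_{d,\beta,h}}\exp\Big\{\frac{d\beta}{n}\Big(\sum_{j=1}^n\sigma_j\Big)^2+h\sum_{j=1}^n\sigma_j\Big\},\qquad \sigma\in\{-1,1\}^n,$$ where $Z_{d,\beta,h}$ is the normalizing constant. Put $\beta_c=\frac1{2d}$ and $$Q_n^+=\sup_{x\in\mathbb R}\ \sup_{v_1,\dots,v_n\ge 1}P\Big(\sum_{i=1}^n v_i\varepsilon_i\in(x-1,x+1)\Big).$$ Then, as $n\to+\infty$ with $d,\beta,h$ fixed, the following hold, where $a_n\sim b_n$ means $a_n/b_n\to1$. (1) If $h=0$ and $\beta<\beta_c$, then $Q_n^+\sim\sqrt{\dfrac{2(1-2d\beta)}{\pi}}\;n^{-1/2}$. (2) If $h=0$ and $\beta=\beta_c$, then $Q_n^+\sim\dfrac{2}{(3/4)^{1/4}\,\Gamma(1/4)}\;n^{-3/4}$.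 (3) If $h=0$ and $\beta>\beta_c$, then the equation $z=\tanh\big(\frac{\beta}{\beta_c}z\big)$ has a largest real solution $z_*$, and $Q_n^+\sim\sqrt{\dfrac{1/(1-z_*^2)-2d\beta}{2\pi}}\;n^{-1/2}$. (4) If $h\neq0$, then the equation $z=\tanh\big(\frac{\beta}{\beta_c}z+|h|\big)$ has a largest real solution $z_*$, and $Q_n^+\sim\sqrt{\dfrac{2\big(1/(1-z_*^2)-2d\beta\big)}{\pi}}\;n^{-1/2}$. -/

import Mathlib

namespace CurieWeiss

/-- The configurations `σ ∈ {-1, 1}ⁿ`; the type `ℤˣ` has exactly the two elements `1` and `-1`. -/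
abbrev Config (n : ℕ) : Type := Fin n → ℤˣ

/-- Every set of spins is measurable, and hence so is every set of configurations. -/
instance : DiscreteMeasurableSpace ℤˣ where
  forall_measurableSet s :=
    ⟨(fun u : ℤˣ => (u : ℤ)) '' s, MeasurableSet.of_discrete,
      Set.preimage_image_eq s Units.val_injective⟩

/-- A spin, viewed as the real number `1` or `-1`. -/
def spin (s : ℤˣ) : ℝ := ((s : ℤ) : ℝ)

/-- The Gibbs weight `exp {(d β / n) (∑ j, σ j)² + h ∑ j, σ j}`. -/
noncomputable def weight (d : ℕ) (β h : ℝ) (n : ℕ) (σ : Config n) : ℝ :=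
  Real.exp ((d : ℝ) * β / (n : ℝ) * (∑ j, spin (σ j)) ^ 2 + h * ∑ j, spin (σ j))

/-- The normalizing constant (partition function). -/
noncomputable def partitionFunction (d : ℕ) (β h : ℝ) (n : ℕ) : ℝ :=
  ∑ σ : Config n, weight d β h n σ

theorem weight_pos (d : ℕ) (β h : ℝ) (n : ℕ) (σ : Config n) : 0 < weight d β h n σ :=
  Real.exp_pos _

theorem partitionFunction_pos (d : ℕ) (β h : ℝ) (n : ℕ) : 0 < partitionFunction d β h n :=
  Finset.sum_pos (fun σ _ => weight_pos d β h n σ) Finset.univ_nonempty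

theorem sum_prob_eq_one (d : ℕ) (β h : ℝ) (n : ℕ) :
    ∑ σ : Config n, ENNReal.ofReal (weight d β h n σ / partitionFunction d β h n) = 1 := by
  rw [← ENNReal.ofReal_sum_of_nonneg
    (fun σ _ => (div_pos (weight_pos d β h n σ) (partitionFunction_pos d β h n)).le),
    ← Finset.sum_div]
  change ENNReal.ofReal (partitionFunction d β h n / partitionFunction d β h n) = 1
  rw [div_self (partitionFunction_pos d β h n).ne', ENNReal.ofReal_one]

/-- The law of the spins `ε = (ε₁, …, εₙ)` of the Curie-Weiss model: the probability of a
configuration `σ` is its Gibbs weight divided by the normalizing constant. -/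
noncomputable def law (d : ℕ) (β h : ℝ) (n : ℕ) : PMF (Config n) :=
  PMF.ofFintype (fun σ => ENNReal.ofReal (weight d β h n σ / partitionFunction d β h n))
    (sum_prob_eq_one d β h n)

/-- `Q_n^+`, the supremum over `x ∈ ℝ` and over `v₁, …, vₙ ≥ 1` of the probability that
`∑ i, v i * ε i` lies in the open interval `(x - 1, x + 1)`. Both suprema are over nonempty
families of numbers in `[0, 1]`. -/
noncomputable def Qplus (d : ℕ) (β h : ℝ) (n : ℕ) : ℝ :=
  ⨆ x : ℝ, ⨆ v : {v : Fin n → ℝ // ∀ i, 1 ≤ v i},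
    (law d β h n).toMeasure.real
      {σ : Config n | ∑ i, v.1 i * spin (σ i) ∈ Set.Ioo (x - 1) (x + 1)}

/-- The critical inverse temperature `β_c = 1 / (2 d)`. -/
noncomputable def betaC (d : ℕ) : ℝ := 1 / (2 * (d : ℝ))

/-- The real solutions of the mean-field equation `z = tanh ((β / β_c) z + |h|)`. -/
def meanFieldSolutions (d : ℕ) (β h : ℝ) : Set ℝ :=
  {z : ℝ | z = Real.tanh (β / betaC d * z + |h|)}

end CurieWeiss

/-!
The configurations `σ` with `∑ i, v i * σ i` in a given open interval of length `2` form an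
antichain when all `v i ≥ 1` (Erdős), and the Gibbs weight depends only on the number `k` of
positive spins. By the LYM inequality the supremum `Qplus` is therefore the largest atom of the law
of the magnetization, attained with `v = 1` (`Qplus_eq`): with `a = 2 d β` it is the quotient of
the largest `levelWeight a h n k` by the sum of all of them. Flipping all spins reduces to `h ≥ 0`.
Numerator and denominator are then compared with `exp (n (log 2 + ψ z))`, where
`ψ y = log cosh (a y + h) - a y² / 2` is the mean-field `potential` and `z` is its maximizer, the
largest solution of `z = tanh (a z + h)`.

*Largest weight* (`tendsto_peakWeight`). A level weight is a binomial probability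
`binomialMode n k`, of known order by Stirling's formula, times the exponential of `n` times the
free energy at `p = k / n`. Convex duality between entropy and `log cosh` bounds the free energy by
`log 2 + ψ (2 p - 1)`, with equality only at solutions of the mean-field equation. So the levels
outside the window `|2 p - 1| ≤ z` are negligible, and inside it the Stirling prefactor is largest
at the ends, which gives `√(2 / (π (1 - z²) n))` in every regime.

*Normalizing constant* (`levelSum_eq_integral`). Writing the quadratic interaction as a Gaussian
mixture of fields turns the sum into `√(n a / 2π) 2ⁿ ∫ exp (n ψ)`, to which Laplace's method
(`tendsto_laplace`) applies. The maximum of `ψ` is unique and nondegenerate if `h > 0` or `a < 1`;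
for `h = 0` and `a > 1` there are two, at `z` and `-z`, which halves the result; for `h = 0` and
`a = 1` the maximum at `0` is quartic, `ψ t ~ -t⁴ / 12`, whence the exponent `3 / 4` and `Γ (1 / 4)`.
For `a = 0` the spins are independent and the sum is explicit.
-/

open Finset Filter Topology

/-! ### Reduction to the law of the magnetization -/

namespace CurieWeiss

/-- The total Gibbs weight of the configurations with exactly `k` spins equal to `1`, with
`a = 2 d β`; their magnetization `∑ j, σ j` is `2 k - n`. -/
noncomputable def levelWeight (a h : ℝ) (n k : ℕ) : ℝ :=
  n.choose k * Real.exp (a / (2 * n) * (2 * k - n) ^ 2 + h * (2 * k - n))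

/-- The largest of the weights `levelWeight a h n k`, `0 ≤ k ≤ n`. -/
noncomputable def peakWeight (a h : ℝ) (n : ℕ) : ℝ :=
  (range (n + 1)).sup' nonempty_range_add_one (levelWeight a h n)

/-- The normalizing constant, as a sum over the number of positive spins. -/
noncomputable def levelSum (a h : ℝ) (n : ℕ) : ℝ :=
  ∑ k ∈ range (n + 1), levelWeight a h n k

theorem levelWeight_nonneg (a h : ℝ) (n k : ℕ) : 0 ≤ levelWeight a h n k := by
  unfold levelWeight; positivity

theorem levelWeight_le_peakWeight (a h : ℝ) {n k : ℕ} (hk : k ≤ n) :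
    levelWeight a h n k ≤ peakWeight a h n :=
  le_sup' (levelWeight a h n) (mem_range.2 (Nat.lt_succ_of_le hk))

theorem peakWeight_nonneg (a h : ℝ) (n : ℕ) : 0 ≤ peakWeight a h n :=
  (levelWeight_nonneg a h n 0).trans (levelWeight_le_peakWeight a h (Nat.zero_le n))

/-- The set of sites with a positive spin. -/
def positiveSites {n : ℕ} (σ : Config n) : Finset (Fin n) := {i | σ i = 1}

theorem positiveSites_bijective (n : ℕ) :
    Function.Bijective (positiveSites : Config n → Finset (Fin n)) := by
  constructor
  · intro σ τ hστ
    funext i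
    have hi : σ i = 1 ↔ τ i = 1 := by
      simpa [positiveSites] using Finset.ext_iff.1 hστ i
    rcases Int.units_eq_one_or (σ i) with h1 | h1 <;>
      rcases Int.units_eq_one_or (τ i) with h2 | h2 <;> simp_all
  · intro s
    refine ⟨fun i => if i ∈ s then 1 else -1, ?_⟩
    ext i
    by_cases hi : i ∈ s <;> simp [positiveSites, hi]

theorem spin_eq (s : ℤˣ) : spin s = if s = 1 then 1 else -1 := by
  rcases Int.units_eq_one_or s with rfl | rfl <;> simp [spin]

theorem sum_spin_eq {n : ℕ} (σ : Config n) :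
    ∑ j, spin (σ j) = 2 * (#(positiveSites σ) : ℝ) - n := by
  have h : ∀ j, spin (σ j) = 2 * (if σ j = 1 then (1 : ℝ) else 0) - 1 := fun j => by
    rw [spin_eq]; split_ifs <;> norm_num
  simp only [h, sum_sub_distrib, ← mul_sum, sum_boole, positiveSites]
  simp

theorem choose_mul_weight (d : ℕ) (β h : ℝ) {n : ℕ} (σ : Config n) :
    n.choose #(positiveSites σ) * weight d β h n σ =
      levelWeight (2 * d * β) h n #(positiveSites σ) := by
  rw [weight, levelWeight, sum_spin_eq]
  congr 3
  rw [mul_assoc, mul_div_mul_left _ _ two_ne_zero]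

theorem weight_eq_levelWeight_mul_inv (d : ℕ) (β h : ℝ) {n : ℕ} (σ : Config n) :
    weight d β h n σ = levelWeight (2 * d * β) h n #(positiveSites σ) *
      ((n.choose #(positiveSites σ) : ℝ))⁻¹ := by
  have hc : (n.choose #(positiveSites σ) : ℝ) ≠ 0 := by
    have := Nat.choose_pos ((card_le_univ (positiveSites σ)).trans_eq (Fintype.card_fin n))
    exact_mod_cast this.ne'
  rw [← choose_mul_weight]; field_simp

theorem sum_weight_level (d : ℕ) (β h : ℝ) {n k : ℕ} :
    ∑ σ : Config n with #(positiveSites σ) = k, weight d β h n σ =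
      levelWeight (2 * d * β) h n k := by
  have hcard : #{σ : Config n | #(positiveSites σ) = k} = n.choose k := by
    have h1 := card_powersetCard k (univ : Finset (Fin n))
    rw [card_fin] at h1
    rw [← h1]
    refine card_bijective _ (positiveSites_bijective n) fun σ => ?_
    simp [mem_powersetCard]
  have h2 : ∀ σ ∈ ({σ : Config n | #(positiveSites σ) = k} : Finset (Config n)),
      weight d β h n σ = levelWeight (2 * d * β) h n k * ((n.choose k : ℝ))⁻¹ := by
    intro σ hσ
    rw [weight_eq_levelWeight_mul_inv, (mem_filter.1 hσ).2]
  rw [sum_congr rfl h2, sum_const, hcard, nsmul_eq_mul]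
  rcases Nat.eq_zero_or_pos (n.choose k) with h0 | h0
  · simp [levelWeight, h0]
  · have : (n.choose k : ℝ) ≠ 0 := by exact_mod_cast h0.ne'
    field_simp

theorem partitionFunction_eq_levelSum (d : ℕ) (β h : ℝ) (n : ℕ) :
    partitionFunction d β h n = levelSum (2 * d * β) h n := by
  rw [partitionFunction, levelSum]
  simp only [← sum_weight_level]
  refine (sum_fiberwise_of_maps_to (fun σ _ => ?_) _).symm
  exact mem_range.2 (Nat.lt_succ_of_le
    ((card_le_univ (positiveSites σ)).trans_eq (Fintype.card_fin n)))

theorem law_real_apply (d : ℕ) (β h : ℝ) (n : ℕ) (A : Finset (Config n)) :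
    (law d β h n).toMeasure.real (A : Set (Config n)) =
      (∑ σ ∈ A, weight d β h n σ) / partitionFunction d β h n := by
  rw [MeasureTheory.measureReal_def, PMF.toMeasure_apply_finset,
    ENNReal.toReal_sum (fun σ _ => PMF.apply_ne_top _ σ), sum_div]
  refine sum_congr rfl fun σ _ => ?_
  rw [law, PMF.ofFintype_apply, ENNReal.toReal_ofReal]
  exact (div_pos (weight_pos d β h n σ) (partitionFunction_pos d β h n)).le

/-- By exchangeability, the weight of a family of configurations is an average of the level
weights, so that the LYM inequality bounds the weight of an antichain by the largest one. -/
theorem sum_weight_le_peakWeight (d : ℕ) (β h : ℝ) {n : ℕ} (A : Finset (Config n))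
    (hA : ∀ σ ∈ A, ∀ τ ∈ A, positiveSites σ ⊆ positiveSites τ → σ = τ) :
    ∑ σ ∈ A, weight d β h n σ ≤ peakWeight (2 * d * β) h n := by
  have hinj : Set.InjOn (positiveSites : Config n → Finset (Fin n)) A :=
    (positiveSites_bijective n).1.injOn
  have hanti : IsAntichain (· ⊆ ·) (SetLike.coe (A.image positiveSites)) := by
    intro s hs t ht hst hsub
    obtain ⟨σ, hσ, rfl⟩ := mem_image.1 (mem_coe.1 hs)
    obtain ⟨τ, hτ, rfl⟩ := mem_image.1 (mem_coe.1 ht)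
    exact hst (congrArg _ (hA σ hσ τ hτ hsub))
  have hlym := lubell_yamamoto_meshalkin_inequality_sum_inv_choose (𝕜 := ℝ) hanti
  rw [sum_image hinj] at hlym
  simp only [Fintype.card_fin] at hlym
  calc ∑ σ ∈ A, weight d β h n σ
      ≤ ∑ σ ∈ A, peakWeight (2 * d * β) h n * ((n.choose #(positiveSites σ) : ℝ))⁻¹ := by
        refine sum_le_sum fun σ _ => ?_
        rw [weight_eq_levelWeight_mul_inv]
        gcongr
        exact levelWeight_le_peakWeight _ _
          ((card_le_univ (positiveSites σ)).trans_eq (Fintype.card_fin n))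
    _ ≤ peakWeight (2 * d * β) h n := by
        rw [← mul_sum]
        exact mul_le_of_le_one_right (peakWeight_nonneg _ _ _) hlym

/-- Erdős's observation: turning a spin from `-1` to `1` raises `∑ i, v i * σ i` by at least `2`,
so the configurations with that sum in an open interval of length `2` form an antichain. -/
theorem eq_of_positiveSites_subset {n : ℕ} {v : Fin n → ℝ} (hv : ∀ i, 1 ≤ v i) {x : ℝ}
    {σ τ : Config n} (hσ : ∑ i, v i * spin (σ i) ∈ Set.Ioo (x - 1) (x + 1))
    (hτ : ∑ i, v i * spin (τ i) ∈ Set.Ioo (x - 1) (x + 1))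
    (hsub : positiveSites σ ⊆ positiveSites τ) : σ = τ := by
  by_contra hne
  have hle : ∀ i, 0 ≤ v i * spin (τ i) - v i * spin (σ i) := by
    intro i
    have hi : σ i = 1 → τ i = 1 := by simpa [positiveSites] using @hsub i
    have := hv i
    rw [spin_eq, spin_eq]
    split_ifs <;> first | linarith | simp_all
  obtain ⟨i, hi⟩ : ∃ i, i ∈ positiveSites τ ∧ i ∉ positiveSites σ := by
    by_contra! hcon
    exact hne ((positiveSites_bijective n).1 (hsub.antisymm hcon))
  have hi2 : 2 ≤ v i * spin (τ i) - v i * spin (σ i) := by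
    have h1 : τ i = 1 := by simpa [positiveSites] using hi.1
    have h2 : σ i ≠ 1 := by simpa [positiveSites] using hi.2
    have := hv i
    rw [spin_eq, spin_eq, if_pos h1, if_neg h2]; linarith
  have hsum : 2 ≤ ∑ i, (v i * spin (τ i) - v i * spin (σ i)) :=
    hi2.trans (single_le_sum (f := fun i => v i * spin (τ i) - v i * spin (σ i))
      (fun j _ => hle j) (mem_univ i))
  rw [sum_sub_distrib] at hsum
  linarith [hσ.1, hτ.2]

/-- The concentration function is the largest atom of the law of the magnetization. -/
theorem Qplus_eq (d : ℕ) (β h : ℝ) (n : ℕ) :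
    Qplus d β h n = peakWeight (2 * d * β) h n / levelSum (2 * d * β) h n := by
  classical
  have hle : ∀ (x : ℝ) (v : {v : Fin n → ℝ // ∀ i, 1 ≤ v i}),
      (law d β h n).toMeasure.real
        {σ : Config n | ∑ i, v.1 i * spin (σ i) ∈ Set.Ioo (x - 1) (x + 1)} ≤
      peakWeight (2 * d * β) h n / levelSum (2 * d * β) h n := by
    intro x v
    have := law_real_apply d β h n
      {σ : Config n | ∑ i, v.1 i * spin (σ i) ∈ Set.Ioo (x - 1) (x + 1)}
    rw [coe_filter_univ] at this
    rw [this, partitionFunction_eq_levelSum]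
    have hZ := partitionFunction_pos d β h n
    rw [partitionFunction_eq_levelSum] at hZ
    refine div_le_div_of_nonneg_right (sum_weight_le_peakWeight d β h _ ?_) hZ.le
    intro σ hσ τ hτ
    exact eq_of_positiveSites_subset v.2 (mem_filter.1 hσ).2 (mem_filter.1 hτ).2
  have hne : Nonempty {v : Fin n → ℝ // ∀ i, 1 ≤ v i} := ⟨⟨fun _ => 1, fun _ => le_rfl⟩⟩
  have hbdd : ∀ x : ℝ, BddAbove (Set.range fun v : {v : Fin n → ℝ // ∀ i, 1 ≤ v i} =>
      (law d β h n).toMeasure.real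
        {σ : Config n | ∑ i, v.1 i * spin (σ i) ∈ Set.Ioo (x - 1) (x + 1)}) :=
    fun x => ⟨_, Set.forall_mem_range.2 (hle x)⟩
  refine le_antisymm (ciSup_le fun x => ciSup_le (hle x)) ?_
  obtain ⟨k, hk, hkmax⟩ := exists_mem_eq_sup' nonempty_range_add_one (levelWeight (2 * d * β) h n)
  refine le_trans ?_ ((le_ciSup (hbdd (2 * k - n)) ⟨fun _ => 1, fun _ => le_rfl⟩).trans
    (le_ciSup (f := fun x => ⨆ v : {v : Fin n → ℝ // ∀ i, 1 ≤ v i},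
      (law d β h n).toMeasure.real
        {σ : Config n | ∑ i, v.1 i * spin (σ i) ∈ Set.Ioo (x - 1) (x + 1)})
      ⟨_, Set.forall_mem_range.2 fun x => ciSup_le (hle x)⟩ (2 * k - n)))
  have := law_real_apply d β h n {σ : Config n | #(positiveSites σ) = k}
  rw [sum_weight_level, partitionFunction_eq_levelSum] at this
  rw [peakWeight, hkmax, ← this]
  refine MeasureTheory.measureReal_mono fun σ hσ => ?_
  have hσ' : #(positiveSites σ) = k := by simpa using hσ
  simp only [one_mul, Set.mem_ofPred_eq, sum_spin_eq, hσ']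
  constructor <;> linarith

end CurieWeiss

/-! ### The largest atom: Stirling's formula and the free energy -/

namespace CurieWeiss

/-- The mean-field potential `ψ(y) = log cosh (a y + h) - a y² / 2`. Its critical points, for
`a ≠ 0`, are the solutions of the mean-field equation `y = tanh (a y + h)`. -/
noncomputable def potential (a h y : ℝ) : ℝ :=
  Real.log (Real.cosh (a * y + h)) - a * y ^ 2 / 2

/-- Entropy plus energy per site of the configurations with a proportion `p` of positive spins,
that is, with magnetization `2 p - 1` per site. -/
noncomputable def freeEnergy (a h p : ℝ) : ℝ :=
  Real.binEntropy p + a * (2 * p - 1) ^ 2 / 2 + h * (2 * p - 1)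

/-- The probability that a binomial variable with parameters `n` and `k / n` takes the value `k`. -/
noncomputable def binomialMode (n k : ℕ) : ℝ :=
  n.choose k * ((k / n : ℝ) ^ k * (1 - k / n : ℝ) ^ (n - k))

theorem binomialMode_nonneg {n k : ℕ} (hk : k ≤ n) : 0 ≤ binomialMode n k := by
  have h1 : (k / n : ℝ) ≤ 1 := div_le_one_of_le₀ (by exact_mod_cast hk) (Nat.cast_nonneg n)
  have h2 : (0 : ℝ) ≤ 1 - k / n := by linarith
  unfold binomialMode; positivity

theorem binomialMode_le_one {n k : ℕ} (hk : k ≤ n) : binomialMode n k ≤ 1 := by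
  have h1 : (k / n : ℝ) ≤ 1 := div_le_one_of_le₀ (by exact_mod_cast hk) (Nat.cast_nonneg n)
  have h2 : (0 : ℝ) ≤ 1 - k / n := by linarith
  have h3 := add_pow (k / n : ℝ) (1 - k / n) n
  rw [add_sub_cancel, one_pow] at h3
  rw [h3]
  refine le_trans (le_of_eq ?_) (single_le_sum
    (f := fun m => (k / n : ℝ) ^ m * (1 - k / n : ℝ) ^ (n - m) * (n.choose m : ℝ))
    (fun m _ => by positivity) (mem_range.2 (Nat.lt_succ_of_le hk)))
  simp only [binomialMode]; ring

theorem pow_mul_pow_eq_exp_binEntropy {n k : ℕ} (hn : 0 < n) (hk : k ≤ n) :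
    (k / n : ℝ) ^ k * (1 - k / n : ℝ) ^ (n - k) =
      Real.exp (-(n * Real.binEntropy (k / n))) := by
  have hn' : (0 : ℝ) < n := by exact_mod_cast hn
  have key : ∀ (p : ℝ) (m : ℕ), 0 ≤ p → n * p = m →
      p ^ m = Real.exp (-(n * Real.negMulLog p)) := by
    intro p m hp hm
    rcases hp.eq_or_lt with rfl | hp
    · have : m = 0 := by simpa using hm.symm
      simp [this]
    · rw [Real.negMulLog, neg_mul, mul_neg, neg_neg, ← mul_assoc, hm,
        Real.exp_nat_mul, Real.exp_log hp]
  have h1 : (k / n : ℝ) ≤ 1 := div_le_one_of_le₀ (by exact_mod_cast hk) hn'.le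
  rw [key (k / n) k (by positivity) (by field_simp), key (1 - k / n) (n - k) (by linarith)
    (by rw [Nat.cast_sub hk]; field_simp), ← Real.exp_add,
    Real.binEntropy_eq_negMulLog_add_negMulLog_one_sub]
  ring_nf

theorem levelWeight_eq_binomialMode_mul_exp (a h : ℝ) {n k : ℕ} (hn : 0 < n) (hk : k ≤ n) :
    levelWeight a h n k = binomialMode n k * Real.exp (n * freeEnergy a h (k / n)) := by
  have hn' : (n : ℝ) ≠ 0 := by exact_mod_cast hn.ne'
  rw [binomialMode, pow_mul_pow_eq_exp_binEntropy hn hk, mul_assoc, ← Real.exp_add, levelWeight,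
    freeEnergy]
  congr 2
  field_simp
  ring

theorem sqrt_mul_binomialMode_eq {n k : ℕ} (hk0 : 0 < k) (hkn : k < n) :
    √n * binomialMode n k = Stirling.stirlingSeq n /
      (Stirling.stirlingSeq k * Stirling.stirlingSeq (n - k)) /
        √(2 * ((k / n : ℝ) * (1 - k / n))) := by
  obtain ⟨m, rfl⟩ := Nat.exists_eq_add_of_lt hkn
  rw [show k + m + 1 = k + (m + 1) by ring] at *
  generalize m + 1 = l at *
  have hl : 0 < l := by omega
  have hk' : (0 : ℝ) < k := by exact_mod_cast hk0
  have hl' : (0 : ℝ) < l := by exact_mod_cast hl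
  have hq : (1 - k / (k + l : ℕ) : ℝ) = l / (k + l : ℕ) := by
    push_cast; field_simp; ring
  have hch : (((k + l).choose k : ℕ) : ℝ) = (k + l).factorial / (k.factorial * l.factorial) := by
    rw [Nat.cast_add_choose]
  rw [binomialMode, hq, hch]
  simp only [Stirling.stirlingSeq, Nat.add_sub_cancel_left]
  have hs : √(2 * (k / (k + l : ℕ) * (l / (k + l : ℕ))) : ℝ) =
      √(2 * k) * √(2 * l) * √((k + l : ℕ) : ℝ) / (√(2 * (k + l : ℕ)) * ((k + l : ℕ) : ℝ)) := by
    have hN : (0 : ℝ) < (k + l : ℕ) := by positivity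
    generalize ((k + l : ℕ) : ℝ) = N at *
    rw [show 2 * (k / N * (l / N)) = (2 * k) * (2 * l) * N / (2 * N * (N * N)) by field_simp]
    rw [Real.sqrt_div (by positivity), Real.sqrt_mul (by positivity), Real.sqrt_mul (by positivity),
      Real.sqrt_mul (by positivity : 0 ≤ 2 * N), Real.sqrt_mul_self hN.le]
  rw [hs]
  have hN : (0 : ℝ) < (k + l : ℕ) := by positivity
  generalize hNN : ((k + l : ℕ) : ℝ) = N at *
  have hsN : √N * √N = N := Real.mul_self_sqrt hN.le
  have h2 : √N ≠ 0 := by positivity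
  have h3 : √(2 * N) ≠ 0 := by positivity
  have h4 : √(2 * (k : ℝ)) ≠ 0 := by positivity
  have h5 : √(2 * (l : ℝ)) ≠ 0 := by positivity
  have hf1 : ((k.factorial : ℕ) : ℝ) ≠ 0 := by positivity
  have hf2 : ((l.factorial : ℕ) : ℝ) ≠ 0 := by positivity
  simp only [div_pow, pow_add]
  have he := Real.exp_ne_zero 1
  generalize √(2 * N) = A at *
  generalize √(2 * (k : ℝ)) = B at *
  generalize √(2 * (l : ℝ)) = C at *
  generalize √N = D at *
  subst hsN
  field_simp

theorem negMulLog_add_mul_log_le {p P : ℝ} (hp : 0 ≤ p) (hP : 0 < P) :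
    Real.negMulLog p + p * Real.log P ≤ P - p ∧
      (p ≠ P → Real.negMulLog p + p * Real.log P < P - p) := by
  rcases hp.eq_or_lt with rfl | hp
  · simp [hP, hP.le]
  · have e : Real.negMulLog p + p * Real.log P = p * Real.log (P / p) := by
      rw [Real.log_div hP.ne' hp.ne', Real.negMulLog]; ring
    have e2 : P - p = p * (P / p - 1) := by field_simp
    rw [e, e2]
    refine ⟨mul_le_mul_of_nonneg_left (Real.log_le_sub_one_of_pos (by positivity)) hp.le,
      fun hne => mul_lt_mul_of_pos_left (Real.log_lt_sub_one_of_pos (by positivity) ?_) hp⟩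
    rw [Ne, div_eq_one_iff_eq hp.ne']
    exact fun h => hne h.symm

theorem one_add_tanh_div_two (u : ℝ) :
    (1 + Real.tanh u) / 2 = Real.exp u / (2 * Real.cosh u) ∧
      1 - Real.exp u / (2 * Real.cosh u) = Real.exp (-u) / (2 * Real.cosh u) := by
  have h := Real.cosh_pos u
  rw [Real.tanh_eq_sinh_div_cosh]
  have h1 := Real.cosh_eq u
  have h2 := Real.sinh_eq u
  constructor <;> field_simp <;> linarith

/-- The convex duality between `binEntropy` and `log cosh`: it is the nonnegativity of the
Kullback-Leibler divergence between two Bernoulli laws, which vanishes only if they agree. -/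
theorem binEntropy_add_le {p : ℝ} (hp0 : 0 ≤ p) (hp1 : p ≤ 1) (u : ℝ) :
    Real.binEntropy p + u * (2 * p - 1) ≤ Real.log 2 + Real.log (Real.cosh u) ∧
    (2 * p - 1 ≠ Real.tanh u →
      Real.binEntropy p + u * (2 * p - 1) < Real.log 2 + Real.log (Real.cosh u)) ∧
    (2 * p - 1 = Real.tanh u →
      Real.binEntropy p + u * (2 * p - 1) = Real.log 2 + Real.log (Real.cosh u)) := by
  have hc := Real.cosh_pos u
  obtain ⟨ht, hQ⟩ := one_add_tanh_div_two u
  have hPpos : 0 < Real.exp u / (2 * Real.cosh u) := by positivity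
  have hQpos : 0 < 1 - Real.exp u / (2 * Real.cosh u) := by rw [hQ]; positivity
  have hlogP : Real.log (Real.exp u / (2 * Real.cosh u)) =
      u - (Real.log 2 + Real.log (Real.cosh u)) := by
    rw [Real.log_div (Real.exp_ne_zero _) (by positivity), Real.log_exp,
      Real.log_mul two_ne_zero hc.ne']
  have hlogQ : Real.log (1 - Real.exp u / (2 * Real.cosh u)) =
      -u - (Real.log 2 + Real.log (Real.cosh u)) := by
    rw [hQ, Real.log_div (Real.exp_ne_zero _) (by positivity), Real.log_exp,
      Real.log_mul two_ne_zero hc.ne']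
  generalize Real.exp u / (2 * Real.cosh u) = P at *
  obtain ⟨a1, a2⟩ := negMulLog_add_mul_log_le hp0 hPpos
  obtain ⟨b1, b2⟩ := negMulLog_add_mul_log_le (sub_nonneg.2 hp1) hQpos
  rw [Real.binEntropy_eq_negMulLog_add_negMulLog_one_sub]
  rw [hlogP] at a1 a2
  rw [hlogQ] at b1 b2
  refine ⟨by linarith, fun hne => ?_, fun he => ?_⟩
  · have := a2 fun hpP => hne (by rw [hpP]; linarith)
    linarith
  · have hpP : p = P := by linarith
    subst hpP
    rw [Real.negMulLog, Real.negMulLog, hlogP, hlogQ]; ring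

theorem freeEnergy_le {p : ℝ} (hp0 : 0 ≤ p) (hp1 : p ≤ 1) (a h : ℝ) :
    freeEnergy a h p ≤ Real.log 2 + potential a h (2 * p - 1) ∧
    (2 * p - 1 ≠ Real.tanh (a * (2 * p - 1) + h) →
      freeEnergy a h p < Real.log 2 + potential a h (2 * p - 1)) ∧
    (2 * p - 1 = Real.tanh (a * (2 * p - 1) + h) →
      freeEnergy a h p = Real.log 2 + potential a h (2 * p - 1)) := by
  obtain ⟨h1, h2, h3⟩ := binEntropy_add_le hp0 hp1 (a * (2 * p - 1) + h)
  have e : freeEnergy a h p = Real.binEntropy p + (a * (2 * p - 1) + h) * (2 * p - 1)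
      - a * (2 * p - 1) ^ 2 / 2 := by rw [freeEnergy]; ring
  rw [e, potential]
  exact ⟨by linarith, fun hne => by linarith [h2 hne], fun he => by linarith [h3 he]⟩

/-- A sequence of levels with proportion converging to an interior maximizer `p` of the free
energy reaches the value predicted by Stirling's formula. -/
theorem tendsto_levelWeight_floor {a h p : ℝ} (hp0 : 0 < p) (hp1 : p < 1)
    (hmax : ∀ q, 0 ≤ q → q ≤ 1 → freeEnergy a h q ≤ freeEnergy a h p) :
    Tendsto (fun n : ℕ => √n * levelWeight a h n ⌊(n : ℝ) * p⌋₊ *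
      Real.exp (-(n * freeEnergy a h p))) atTop (𝓝 (1 / √(2 * Real.pi * (p * (1 - p))))) := by
  have hcast : Tendsto (fun n : ℕ => (n : ℝ)) atTop atTop := tendsto_natCast_atTop_atTop
  have hkn : Tendsto (fun n : ℕ => ((⌊(n : ℝ) * p⌋₊ : ℕ) / n : ℝ)) atTop (𝓝 p) := by
    have := (tendsto_nat_floor_mul_div_atTop (R := ℝ) hp0.le).comp hcast
    refine this.congr fun n => ?_
    simp [mul_comm]
  have hk : Tendsto (fun n : ℕ => ⌊(n : ℝ) * p⌋₊) atTop atTop :=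
    tendsto_nat_floor_atTop.comp (hcast.atTop_mul_const hp0)
  have hle : ∀ n : ℕ, ⌊(n : ℝ) * p⌋₊ ≤ n := fun n =>
    Nat.floor_le_of_le (mul_le_of_le_one_right (Nat.cast_nonneg n) hp1.le)
  have hl : Tendsto (fun n : ℕ => n - ⌊(n : ℝ) * p⌋₊) atTop atTop := by
    rw [← tendsto_natCast_atTop_iff (R := ℝ)]
    refine tendsto_atTop_mono (f := fun n : ℕ => (n : ℝ) * (1 - p)) (fun n => ?_)
      (hcast.atTop_mul_const (by linarith))
    rw [Nat.cast_sub (hle n)]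
    have := Nat.floor_le (a := (n : ℝ) * p) (by positivity)
    linarith
  have hS := Stirling.tendsto_stirlingSeq_sqrt_pi
  have hpi : √Real.pi ≠ 0 := by positivity
  have hpq : 0 < p * (1 - p) := mul_pos hp0 (by linarith)
  have hmain : Tendsto (fun n : ℕ => Stirling.stirlingSeq n /
      (Stirling.stirlingSeq ⌊(n : ℝ) * p⌋₊ * Stirling.stirlingSeq (n - ⌊(n : ℝ) * p⌋₊)) /
        √(2 * ((⌊(n : ℝ) * p⌋₊ / n : ℝ) * (1 - ⌊(n : ℝ) * p⌋₊ / n)))) atTop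
      (𝓝 (√Real.pi / (√Real.pi * √Real.pi) / √(2 * (p * (1 - p))))) := by
    refine (hS.div ((hS.comp hk).mul (hS.comp hl)) (mul_ne_zero hpi hpi)).div ?_ (by positivity)
    exact ((hkn.mul (tendsto_const_nhds.sub hkn)).const_mul 2).sqrt
  have hval : √Real.pi / (√Real.pi * √Real.pi) / √(2 * (p * (1 - p))) =
      1 / √(2 * Real.pi * (p * (1 - p))) := by
    rw [show 2 * Real.pi * (p * (1 - p)) = Real.pi * (2 * (p * (1 - p))) by ring,
      Real.sqrt_mul Real.pi_pos.le]
    field_simp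
  -- The maximum is interior, so the derivative vanishes and rounding costs only `o(1)`.
  have hderiv : HasDerivAt (freeEnergy a h) 0 p := by
    have hd : DifferentiableAt ℝ (freeEnergy a h) p := by
      unfold freeEnergy
      have := Real.differentiableAt_binEntropy hp0.ne' hp1.ne
      fun_prop
    have hloc : IsLocalMax (freeEnergy a h) p := by
      filter_upwards [Icc_mem_nhds hp0 hp1] with q hq using hmax q hq.1 hq.2
    have := hd.hasDerivAt
    rwa [hloc.hasDerivAt_eq_zero this] at this
  have hO : (fun n : ℕ => ((⌊(n : ℝ) * p⌋₊ : ℕ) / n : ℝ) - p) =O[atTop]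
      (fun n : ℕ => ((n : ℝ))⁻¹) := by
    refine Asymptotics.IsBigO.of_bound 1 ?_
    filter_upwards [eventually_gt_atTop 0] with n hn
    have hn' : (0 : ℝ) < n := by exact_mod_cast hn
    have h1 := Nat.floor_le (a := (n : ℝ) * p) (by positivity)
    have h2 := Nat.lt_floor_add_one ((n : ℝ) * p)
    rw [show ((⌊(n : ℝ) * p⌋₊ : ℕ) / n : ℝ) - p = (⌊(n : ℝ) * p⌋₊ - n * p) * (n : ℝ)⁻¹ by
      field_simp, norm_mul]
    gcongr
    rw [Real.norm_eq_abs, abs_le]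
    constructor <;> linarith
  have hexp : Tendsto (fun n : ℕ => (n : ℝ) *
      (freeEnergy a h (⌊(n : ℝ) * p⌋₊ / n) - freeEnergy a h p)) atTop (𝓝 0) := by
    have h1 := (hasDerivAt_iff_isLittleO.1 hderiv).comp_tendsto hkn
    have h2 := h1.trans_isBigO hO
    rw [Asymptotics.isLittleO_iff_tendsto' (by
      filter_upwards [eventually_gt_atTop 0] with n hn h0
      simp at h0; omega)] at h2
    refine h2.congr fun n => ?_
    simp [mul_comm]
  have hprod := hmain.mul ((Real.continuous_exp.tendsto 0).comp hexp)
  rw [Real.exp_zero, mul_one, hval] at hprod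
  refine hprod.congr' ?_
  filter_upwards [eventually_gt_atTop 0, hk.eventually_gt_atTop 0, hl.eventually_gt_atTop 0]
    with n hn hk0 hl0
  rw [levelWeight_eq_binomialMode_mul_exp a h hn (hle n), ← mul_assoc √(n : ℝ),
    sqrt_mul_binomialMode_eq hk0 (by omega), mul_assoc, ← Real.exp_add, Function.comp_apply]
  ring_nf

theorem sqrt_mul_binomialMode_le {n k : ℕ} (hk0 : 0 < k) (hkn : k < n) {m : ℝ} (hm : 0 < m)
    (hmk : m ≤ (k / n : ℝ) * (1 - k / n)) :
    √n * binomialMode n k ≤ Stirling.stirlingSeq n / (√Real.pi * √Real.pi) / √(2 * m) := by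
  rw [sqrt_mul_binomialMode_eq hk0 hkn]
  have h1 := Stirling.sqrt_pi_le_stirlingSeq hk0.ne'
  have h2 := Stirling.sqrt_pi_le_stirlingSeq (n := n - k) (by omega)
  have h3 := Stirling.sqrt_pi_le_stirlingSeq (n := n) (by omega)
  have h4 : 0 < √Real.pi := by positivity
  have h5 : 0 < Stirling.stirlingSeq n := h4.trans_le h3
  have h6 : 0 < Stirling.stirlingSeq k := h4.trans_le h1
  gcongr

/-- Asymptotics of the largest level weight, when the proportion `p ≥ 1 / 2` maximizes the free
energy and no maximizer lies outside `[1 - p, p]`. -/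
theorem tendsto_peakWeight_of_isMax {a h p : ℝ} (hp0 : 1 / 2 ≤ p) (hp1 : p < 1)
    (hmax : ∀ q, 0 ≤ q → q ≤ 1 → freeEnergy a h q ≤ freeEnergy a h p)
    (hstrict : ∀ q, 0 ≤ q → q ≤ 1 → (q < 1 - p ∨ p < q) → freeEnergy a h q < freeEnergy a h p) :
    Tendsto (fun n : ℕ => √n * peakWeight a h n * Real.exp (-(n * freeEnergy a h p))) atTop
      (𝓝 (1 / √(2 * Real.pi * (p * (1 - p))))) := by
  have hp : 0 < p := by linarith
  have hpq : 0 < p * (1 - p) := mul_pos hp (by linarith)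
  rw [tendsto_order]
  constructor
  · intro b hb
    filter_upwards [(tendsto_order.1 (tendsto_levelWeight_floor hp hp1 hmax)).1 b hb] with n hn
    refine hn.trans_le ?_
    gcongr
    exact levelWeight_le_peakWeight a h
      (Nat.floor_le_of_le (mul_le_of_le_one_right (Nat.cast_nonneg n) hp1.le))
  · intro b hb
    have hb0 : 0 < b := lt_of_le_of_lt (by positivity) hb
    -- A slightly larger window `[1 - p₁, p₁]`, on which the Stirling prefactor stays below `b`.
    obtain ⟨p₁, hpp₁, hp₁1, hp₁b⟩ : ∃ p₁, p < p₁ ∧ p₁ < 1 ∧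
        1 / √(2 * Real.pi * (p₁ * (1 - p₁))) < b := by
      have hcont : ContinuousAt (fun x : ℝ => 1 / √(2 * Real.pi * (x * (1 - x)))) p := by
        refine ContinuousAt.div continuousAt_const (by fun_prop) ?_
        have := Real.pi_pos
        positivity
      have hev := (hcont.eventually (gt_mem_nhds hb)).filter_mono
        (nhdsWithin_le_nhds (s := Set.Ioi p))
      obtain ⟨x, hx1, hx2⟩ := (hev.and (Ioo_mem_nhdsGT hp1)).exists
      exact ⟨x, hx2.1, hx2.2, hx1⟩
    have hm : 0 < p₁ * (1 - p₁) := mul_pos (by linarith) (by linarith)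
    -- Outside the window the free energy is smaller by a fixed amount.
    obtain ⟨η, hη, hgap⟩ : ∃ η > 0, ∀ q ∈ Set.Icc 0 (1 - p₁) ∪ Set.Icc p₁ 1,
        freeEnergy a h q ≤ freeEnergy a h p - η := by
      have hcomp : IsCompact (Set.Icc 0 (1 - p₁) ∪ Set.Icc p₁ 1) :=
        isCompact_Icc.union isCompact_Icc
      have hfc : Continuous (freeEnergy a h) := by unfold freeEnergy; fun_prop
      obtain ⟨q, hq, hqmax⟩ := hcomp.exists_isMaxOn
        ⟨1, Or.inr ⟨hp₁1.le, le_rfl⟩⟩ hfc.continuousOn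
      refine ⟨freeEnergy a h p - freeEnergy a h q, ?_, fun r hr => by
        have := hqmax hr
        simp only [Set.mem_ofPred_eq] at this
        linarith⟩
      have : freeEnergy a h q < freeEnergy a h p := by
        rcases hq with hq | hq
        · exact hstrict q hq.1 (by linarith [hq.2]) (Or.inl (by linarith [hq.2]))
        · exact hstrict q (by linarith [hq.1]) hq.2 (Or.inr (by linarith [hq.1]))
      linarith
    have hcentral : Tendsto (fun n : ℕ => Stirling.stirlingSeq n / (√Real.pi * √Real.pi) /
        √(2 * (p₁ * (1 - p₁)))) atTop (𝓝 (1 / √(2 * Real.pi * (p₁ * (1 - p₁))))) := by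
      have := (Stirling.tendsto_stirlingSeq_sqrt_pi.div_const (√Real.pi * √Real.pi)).div_const
        √(2 * (p₁ * (1 - p₁)))
      convert this using 2
      rw [show 2 * Real.pi * (p₁ * (1 - p₁)) = Real.pi * (2 * (p₁ * (1 - p₁))) by ring,
        Real.sqrt_mul Real.pi_pos.le]
      have : √Real.pi ≠ 0 := by positivity
      field_simp
    have htail : Tendsto (fun n : ℕ => √n * Real.exp (-(η * n))) atTop (𝓝 0) := by
      have := (tendsto_rpow_mul_exp_neg_mul_atTop_nhds_zero (1 / 2) η hη).comp
        (tendsto_natCast_atTop_atTop (R := ℝ))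
      refine this.congr fun n => ?_
      simp [Real.sqrt_eq_rpow]
    filter_upwards [hcentral.eventually (gt_mem_nhds hp₁b), htail.eventually (gt_mem_nhds hb0),
      eventually_gt_atTop 0] with n hn1 hn2 hn
    have hn' : (0 : ℝ) < n := by exact_mod_cast hn
    obtain ⟨k, hk, hkmax⟩ := exists_mem_eq_sup' nonempty_range_add_one (levelWeight a h n)
    have hkn : k ≤ n := Nat.lt_succ_iff.1 (mem_range.1 hk)
    have hk1 : (k / n : ℝ) ≤ 1 := div_le_one_of_le₀ (by exact_mod_cast hkn) hn'.le
    have hk0 : (0 : ℝ) ≤ k / n := by positivity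
    rw [peakWeight, hkmax, levelWeight_eq_binomialMode_mul_exp a h hn hkn, ← mul_assoc,
      mul_assoc _ (Real.exp _), ← Real.exp_add]
    have hB := binomialMode_nonneg hkn
    by_cases hwin : 1 - p₁ < (k / n : ℝ) ∧ (k / n : ℝ) < p₁
    · have hk00 : 0 < k := by
        rcases Nat.eq_zero_or_pos k with rfl | h0
        · have := hwin.1; simp at this; linarith
        · exact h0
      have hknn : k < n := by
        refine lt_of_le_of_ne hkn ?_
        rintro rfl
        have := hwin.2
        rw [div_self hn'.ne'] at this; linarith
      refine lt_of_le_of_lt ?_ hn1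
      refine le_trans ?_ (sqrt_mul_binomialMode_le hk00 hknn hm (by nlinarith [hwin.1, hwin.2]))
      refine mul_le_of_le_one_right (by positivity) (Real.exp_le_one_iff.2 ?_)
      nlinarith [hmax _ hk0 hk1]
    · refine lt_of_le_of_lt ?_ hn2
      have hmem : (k / n : ℝ) ∈ Set.Icc 0 (1 - p₁) ∪ Set.Icc p₁ 1 := by
        by_cases h1 : 1 - p₁ < (k / n : ℝ)
        · exact Or.inr ⟨not_lt.1 fun h2 => hwin ⟨h1, h2⟩, hk1⟩
        · exact Or.inl ⟨hk0, not_lt.1 h1⟩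
      have hg := hgap _ hmem
      refine mul_le_mul (mul_le_of_le_one_right (by positivity) (binomialMode_le_one hkn))
        (Real.exp_le_exp.2 ?_) (by positivity) (by positivity)
      nlinarith

/-- Asymptotics of the largest level weight in terms of the mean-field potential. -/
theorem tendsto_peakWeight {a h z : ℝ} (hz0 : 0 ≤ z) (hz : z = Real.tanh (a * z + h))
    (hsol : ∀ y, y = Real.tanh (a * y + h) → |y| ≤ z)
    (hmax : ∀ y, potential a h y ≤ potential a h z) :
    Tendsto (fun n : ℕ => √n * peakWeight a h n *
      Real.exp (-(n * (Real.log 2 + potential a h z)))) atTop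
      (𝓝 √(2 / (Real.pi * (1 - z ^ 2)))) := by
  have hz1 : z < 1 := hz ▸ Real.tanh_lt_one _
  have e : 2 * ((1 + z) / 2) - 1 = z := by ring
  have hstar : freeEnergy a h ((1 + z) / 2) = Real.log 2 + potential a h z := by
    have := (freeEnergy_le (p := (1 + z) / 2) (by linarith) (by linarith) a h).2.2
    rw [e] at this
    exact this hz
  have := tendsto_peakWeight_of_isMax (a := a) (h := h) (p := (1 + z) / 2) (by linarith)
    (by linarith) ?_ ?_
  · rw [hstar] at this
    convert this using 2
    rw [one_div, ← Real.sqrt_inv]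
    congr 1
    have : 1 - z ^ 2 ≠ 0 := by nlinarith
    have hpi := Real.pi_ne_zero
    rw [show (1 + z) / 2 * (1 - (1 + z) / 2) = (1 - z ^ 2) / 4 by ring]
    field_simp
    norm_num
  · intro q h0 h1
    rw [hstar]
    linarith [(freeEnergy_le h0 h1 a h).1, hmax (2 * q - 1)]
  · intro q h0 h1 hq
    rw [hstar]
    have hne : 2 * q - 1 ≠ Real.tanh (a * (2 * q - 1) + h) := by
      intro he
      have := abs_le.1 (hsol _ he)
      rcases hq with hq | hq <;> linarith [this.1, this.2]
    linarith [(freeEnergy_le h0 h1 a h).2.1 hne, hmax (2 * q - 1)]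

end CurieWeiss

/-! ### The normalizing constant: Hubbard-Stratonovich transformation -/

namespace CurieWeiss

theorem sum_choose_mul_exp (u : ℝ) (n : ℕ) :
    ∑ k ∈ range (n + 1), n.choose k * Real.exp (u * (2 * k - n)) = (2 * Real.cosh u) ^ n := by
  have h : 2 * Real.cosh u = Real.exp u + Real.exp (-u) := by rw [Real.cosh_eq]; ring
  rw [h, add_pow]
  refine sum_congr rfl fun k hk => ?_
  have hk : k ≤ n := Nat.lt_succ_iff.1 (mem_range.1 hk)
  rw [mul_comm, ← Real.exp_nat_mul, ← Real.exp_nat_mul, ← Real.exp_add, Nat.cast_sub hk]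
  ring_nf

theorem levelSum_of_zero (h : ℝ) (n : ℕ) :
    levelSum 0 h n = Real.exp (n * (Real.log 2 + Real.log (Real.cosh h))) := by
  have := Real.cosh_pos h
  rw [Real.exp_nat_mul, Real.exp_add, Real.exp_log two_pos, Real.exp_log this,
    ← sum_choose_mul_exp]
  simp [levelSum, levelWeight]

theorem integrable_gaussian_mul_exp {b : ℝ} (hb : 0 < b) (s : ℝ) :
    MeasureTheory.Integrable (fun y : ℝ => Real.exp (-b * y ^ 2 / 2) * Real.exp (b * y * s)) := by
  have h := ((integrable_exp_neg_mul_sq (half_pos hb)).comp_sub_right s).const_mul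
    (Real.exp (b * s ^ 2 / 2))
  refine h.congr (Eventually.of_forall fun y => ?_)
  simp only [← Real.exp_add]
  ring_nf

theorem integral_gaussian_mul_exp {b : ℝ} (hb : 0 < b) (s : ℝ) :
    ∫ y : ℝ, Real.exp (-b * y ^ 2 / 2) * Real.exp (b * y * s) =
      √(2 * Real.pi / b) * Real.exp (b * s ^ 2 / 2) := by
  have h : ∀ y : ℝ, Real.exp (-b * y ^ 2 / 2) * Real.exp (b * y * s) =
      Real.exp (b * s ^ 2 / 2) * Real.exp (-(b / 2) * (y - s) ^ 2) := fun y => by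
    simp only [← Real.exp_add]
    ring_nf
  simp only [h]
  rw [MeasureTheory.integral_const_mul,
    MeasureTheory.integral_sub_right_eq_self (fun y : ℝ => Real.exp (-(b / 2) * y ^ 2)) s,
    integral_gaussian, mul_comm]
  congr 2
  field_simp

/-- The Hubbard-Stratonovich transformation: the quadratic interaction is a Gaussian mixture of
external fields, under each of which the spins are independent. -/
theorem levelSum_eq_integral {a : ℝ} (ha : 0 < a) (h : ℝ) {n : ℕ} (hn : 0 < n) :
    levelSum a h n = √(n * a / (2 * Real.pi)) * 2 ^ n *
      ∫ y : ℝ, Real.exp (n * potential a h y) := by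
  have hn' : (0 : ℝ) < n := by exact_mod_cast hn
  have hb : 0 < n * a := mul_pos hn' ha
  have hpi := Real.pi_pos
  have hterm : ∀ k : ℕ, levelWeight a h n k = √(n * a / (2 * Real.pi)) *
      ∫ y : ℝ, n.choose k * Real.exp (h * (2 * k - n)) *
        (Real.exp (-(n * a) * y ^ 2 / 2) * Real.exp (n * a * y * ((2 * k - n) / n))) := by
    intro k
    have hs : √(n * a / (2 * Real.pi)) * √(2 * Real.pi / (n * a)) = 1 := by
      rw [← Real.sqrt_mul (by positivity), ← Real.sqrt_one]
      congr 1
      field_simp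
    rw [MeasureTheory.integral_const_mul, integral_gaussian_mul_exp hb, mul_left_comm,
      ← mul_assoc √_ √_, hs, one_mul, mul_assoc, ← Real.exp_add, levelWeight]
    congr 2
    field_simp
    ring
  have hpt : ∀ y : ℝ, ∑ k ∈ range (n + 1), n.choose k * Real.exp (h * (2 * k - n)) *
        (Real.exp (-(n * a) * y ^ 2 / 2) * Real.exp (n * a * y * ((2 * k - n) / n))) =
      2 ^ n * Real.exp (n * potential a h y) := by
    intro y
    have hc := Real.cosh_pos (a * y + h)
    have h1 : 2 ^ n * Real.exp (n * potential a h y) =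
        Real.exp (-(n * a) * y ^ 2 / 2) * (2 * Real.cosh (a * y + h)) ^ n := by
      rw [potential, mul_sub, sub_eq_add_neg, Real.exp_add, Real.exp_nat_mul, Real.exp_log hc,
        mul_pow]
      ring_nf
    rw [h1, ← sum_choose_mul_exp, mul_sum]
    refine sum_congr rfl fun k _ => ?_
    have h2 : (a * y + h) * (2 * k - n) = h * (2 * k - n) + n * a * y * ((2 * k - n) / n) := by
      field_simp; ring
    rw [h2, Real.exp_add]
    ring
  rw [levelSum]
  simp only [hterm]
  rw [← mul_sum, mul_assoc, ← MeasureTheory.integral_const_mul,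
    ← MeasureTheory.integral_finsetSum _ fun k _ =>
      (integrable_gaussian_mul_exp hb _).const_mul _]
  simp only [hpt]

end CurieWeiss

/-! ### Laplace's method -/

/-- An upper bound which is uniform in the rescaling by `n ^ (1 / m)` in Laplace's method: near
the maximum `z` of `f` the bound follows from its Taylor expansion, on bounded sets from
compactness, and at infinity from quadratic decay. -/
theorem exists_le_neg_mul_min_pow {f : ℝ → ℝ} {D : Set ℝ} {z κ R c₁ : ℝ} {m : ℕ}
    (hm : Even m) (hm0 : m ≠ 0) (hf : Continuous f) (hD : IsClosed D) (hf0 : f z = 0) (hκ : 0 < κ)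
    (hloc : Tendsto (fun t => f (z + t) / t ^ m) (𝓝[≠] 0) (𝓝 (-κ)))
    (hneg : ∀ y ∈ D, y ≠ z → f y < 0) (hc₁ : 0 < c₁)
    (hinf : ∀ y ∈ D, R ≤ |y - z| → f y ≤ -c₁ * (y - z) ^ 2) :
    ∃ c > 0, ∀ y ∈ D, f y ≤ -c * min ((y - z) ^ m) ((y - z) ^ 2) := by
  obtain ⟨δ, hδ, hnear⟩ : ∃ δ > 0, ∀ t : ℝ, |t| < δ → f (z + t) ≤ -(κ / 2) * t ^ m := by
    have hev := hloc.eventually (gt_mem_nhds (show -κ < -(κ / 2) by linarith))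
    rw [eventually_nhdsWithin_iff, Metric.eventually_nhds_iff] at hev
    obtain ⟨δ, hδ, h⟩ := hev
    refine ⟨δ, hδ, fun t ht => ?_⟩
    rcases eq_or_ne t 0 with rfl | ht0
    · rw [add_zero, hf0]
      simp [hm0]
    · have h1 := h (by simpa using ht) ht0
      have h2 : 0 < t ^ m := hm.pow_pos ht0
      rw [div_lt_iff₀ h2] at h1
      exact h1.le
  obtain ⟨c₂, hc₂, hmid⟩ : ∃ c₂ > 0, ∀ y ∈ D, δ ≤ |y - z| → |y - z| ≤ R →
      f y ≤ -c₂ * (y - z) ^ 2 := by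
    have hK : IsCompact (D ∩ (Metric.closedBall z R ∩ {y | δ ≤ |y - z|})) := by
      refine IsCompact.inter_left ?_ hD
      exact (isCompact_closedBall z R).inter_right
        (isClosed_le continuous_const (by fun_prop))
    have hmem : ∀ y, y ∈ D ∩ (Metric.closedBall z R ∩ {y | δ ≤ |y - z|}) ↔
        y ∈ D ∧ |y - z| ≤ R ∧ δ ≤ |y - z| := by
      intro y; simp [Real.dist_eq]
    rcases (D ∩ (Metric.closedBall z R ∩ {y | δ ≤ |y - z|})).eq_empty_or_nonempty with he | hne
    · refine ⟨1, one_pos, fun y hy h1 h2 => ?_⟩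
      have : y ∈ D ∩ (Metric.closedBall z R ∩ {y | δ ≤ |y - z|}) := (hmem y).2 ⟨hy, h2, h1⟩
      rw [he] at this
      exact this.elim
    · have hyz : ∀ y ∈ D ∩ (Metric.closedBall z R ∩ {y | δ ≤ |y - z|}), y - z ≠ 0 := by
        intro y hy h0
        have := ((hmem y).1 hy).2.2
        rw [h0, abs_zero] at this
        linarith
      obtain ⟨y₀, hy₀, hmax⟩ := hK.exists_isMaxOn (f := fun y => f y / (y - z) ^ 2) hne
        (hf.continuousOn.div (by fun_prop) fun y hy => pow_ne_zero 2 (hyz y hy))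
      refine ⟨-(f y₀ / (y₀ - z) ^ 2), ?_, fun y hy h1 h2 => ?_⟩
      · have h3 := hneg y₀ hy₀.1 (sub_ne_zero.1 (hyz y₀ hy₀))
        have h4 : 0 < (y₀ - z) ^ 2 := by have := hyz y₀ hy₀; positivity
        rw [gt_iff_lt, neg_pos]
        exact div_neg_of_neg_of_pos h3 h4
      · have hy' := (hmem y).2 ⟨hy, h2, h1⟩
        have h4 : 0 < (y - z) ^ 2 := by have := hyz y hy'; positivity
        have h5 := hmax hy'
        simp only [Set.mem_ofPred_eq] at h5
        rw [div_le_iff₀ h4] at h5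
        rw [neg_neg]
        exact h5
  refine ⟨min (κ / 2) (min c₂ c₁), by positivity, fun y hy => ?_⟩
  have hp1 : 0 ≤ (y - z) ^ m := hm.pow_nonneg _
  have hp2 : 0 ≤ (y - z) ^ 2 := sq_nonneg _
  have hp3 : 0 ≤ min ((y - z) ^ m) ((y - z) ^ 2) := le_min hp1 hp2
  have key : ∀ c A : ℝ, 0 < c → min (κ / 2) (min c₂ c₁) ≤ c →
      min ((y - z) ^ m) ((y - z) ^ 2) ≤ A → f y ≤ -c * A →
      f y ≤ -min (κ / 2) (min c₂ c₁) * min ((y - z) ^ m) ((y - z) ^ 2) := by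
    intro c A hc hcm hA hfy
    have := mul_le_mul hcm hA hp3 hc.le
    linarith
  rcases lt_or_ge |y - z| δ with h1 | h1
  · have := hnear (y - z) h1
    rw [add_sub_cancel] at this
    exact key _ _ (by positivity) (min_le_left _ _) (min_le_left _ _) this
  · rcases le_total |y - z| R with h2 | h2
    · exact key _ _ hc₂ ((min_le_right _ _).trans (min_le_left _ _)) (min_le_right _ _)
        (hmid y hy h1 h2)
    · exact key _ _ hc₁ ((min_le_right _ _).trans (min_le_right _ _)) (min_le_right _ _)
        (hinf y hy h2)

/-- Laplace's method on the line, at an interior maximum `z` where `f (z + t) ~ -κ t ^ m`. -/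
theorem tendsto_laplace {f : ℝ → ℝ} {D : Set ℝ} {z κ R c₁ : ℝ} {m : ℕ}
    (hm : Even m) (hm2 : 2 ≤ m) (hf : Continuous f) (hD : IsClosed D) (hDz : D ∈ 𝓝 z)
    (hf0 : f z = 0) (hκ : 0 < κ)
    (hloc : Tendsto (fun t => f (z + t) / t ^ m) (𝓝[≠] 0) (𝓝 (-κ)))
    (hneg : ∀ y ∈ D, y ≠ z → f y < 0) (hc₁ : 0 < c₁)
    (hinf : ∀ y ∈ D, R ≤ |y - z| → f y ≤ -c₁ * (y - z) ^ 2) :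
    Tendsto (fun n : ℕ => (n : ℝ) ^ (1 / m : ℝ) * ∫ y in D, Real.exp (n * f y)) atTop
      (𝓝 (∫ x : ℝ, Real.exp (-κ * x ^ m))) := by
  have hm0 : m ≠ 0 := by omega
  obtain ⟨c, hc, hdom⟩ := exists_le_neg_mul_min_pow hm hm0 hf hD hf0 hκ hloc hneg hc₁ hinf
  set s : ℕ → ℝ := fun n => (n : ℝ) ^ (1 / m : ℝ) with hs
  have hspow : ∀ n, s n ^ m = n := fun n => by
    simp only [hs, one_div]
    exact Real.rpow_inv_natCast_pow (Nat.cast_nonneg n) hm0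
  have hs1 : ∀ n : ℕ, 0 < n → 1 ≤ s n := fun n hn =>
    Real.one_le_rpow (by exact_mod_cast hn) (by positivity)
  have hs_lim : Tendsto s atTop atTop :=
    (tendsto_rpow_atTop (by positivity)).comp tendsto_natCast_atTop_atTop
  -- Rescaling `y = z + x / s n` turns the integrals into ones with an integrable majorant.
  let F : ℕ → ℝ → ℝ := fun n x => D.indicator (fun y => Real.exp (n * f y)) (z + x / s n)
  have hFint : ∀ n : ℕ, 0 < n → ∫ x, F n x = s n * ∫ y in D, Real.exp (n * f y) := by
    intro n hn
    have h1 := MeasureTheory.Measure.integral_comp_div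
      (fun x => D.indicator (fun y => Real.exp (n * f y)) (z + x)) (s n)
    have h2 := MeasureTheory.integral_add_left_eq_self (μ := MeasureTheory.volume)
      (D.indicator (fun y => Real.exp (n * f y))) z
    rw [h2, MeasureTheory.integral_indicator hD.measurableSet,
      abs_of_pos (by linarith [hs1 n hn]), smul_eq_mul] at h1
    exact h1
  have hlim : Tendsto (fun n => ∫ x, F n x) atTop (𝓝 (∫ x : ℝ, Real.exp (-κ * x ^ m))) := by
    refine MeasureTheory.tendsto_integral_filter_of_dominated_convergence
      (fun x => Real.exp c * Real.exp (-c * x ^ 2)) ?_ ?_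
      ((integrable_exp_neg_mul_sq hc).const_mul _) ?_
    · refine Eventually.of_forall fun n => Measurable.aestronglyMeasurable ?_
      have h1 : Measurable (D.indicator fun y => Real.exp (n * f y)) :=
        Measurable.indicator (by fun_prop) hD.measurableSet
      exact h1.comp (by fun_prop)
    · filter_upwards [eventually_gt_atTop 0] with n hn
      refine Eventually.of_forall fun x => ?_
      rw [Real.norm_eq_abs, abs_of_nonneg (Set.indicator_nonneg (fun _ _ => (Real.exp_pos _).le) _)]
      by_cases hy : z + x / s n ∈ D
      · rw [Set.indicator_of_mem hy]
        have hs1n := hs1 n hn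
        have hs0 : 0 < s n := by linarith
        have hn' : (0 : ℝ) < n := by exact_mod_cast hn
        rw [← Real.exp_add]
        refine Real.exp_le_exp.2 ?_
        have h1 := hdom _ hy
        rw [add_sub_cancel_left] at h1
        have h2 : x ^ 2 - 1 ≤ n * min ((x / s n) ^ m) ((x / s n) ^ 2) := by
          rw [mul_min_of_nonneg _ _ hn'.le, le_min_iff]
          constructor
          · rw [div_pow, hspow, mul_div_cancel₀ _ hn'.ne']
            rcases le_total |x| 1 with hx | hx
            · have := hm.pow_nonneg x
              have := (sq_le_one_iff_abs_le_one x).2 hx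
              linarith
            · have h3 := pow_le_pow_right₀ hx hm2
              rw [sq_abs, hm.pow_abs] at h3
              linarith
          · have h3 : s n ^ 2 ≤ n := by
              rw [← hspow n]
              exact pow_le_pow_right₀ hs1n hm2
            rw [div_pow, mul_div_assoc', le_div_iff₀ (by positivity)]
            nlinarith [sq_nonneg x, sq_nonneg (s n)]
        nlinarith
      · rw [Set.indicator_of_notMem hy]
        positivity
    · refine Eventually.of_forall fun x => ?_
      have hx0 : Tendsto (fun n => x / s n) atTop (𝓝 0) := hs_lim.const_div_atTop x
      have hmem : ∀ᶠ n in atTop, z + x / s n ∈ D := by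
        have : Tendsto (fun n => z + x / s n) atTop (𝓝 z) := by
          simpa using hx0.const_add z
        exact this.eventually hDz
      have hval : Tendsto (fun n : ℕ => n * f (z + x / s n)) atTop (𝓝 (-κ * x ^ m)) := by
        rcases eq_or_ne x 0 with rfl | hx
        · simp [hf0, hm0]
        · have h1 : Tendsto (fun n => x / s n) atTop (𝓝[≠] 0) := by
            refine tendsto_nhdsWithin_iff.2 ⟨hx0, ?_⟩
            filter_upwards [eventually_gt_atTop 0] with n hn
            exact div_ne_zero hx (by linarith [hs1 n hn])
          have h2 := (hloc.comp h1).mul_const (x ^ m)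
          refine h2.congr' ?_
          filter_upwards [eventually_gt_atTop 0] with n hn
          have hn' : (n : ℝ) ≠ 0 := by exact_mod_cast hn.ne'
          have hxm : x ^ m ≠ 0 := pow_ne_zero m hx
          simp only [Function.comp_apply, div_pow, hspow]
          field_simp
      refine ((Real.continuous_exp.tendsto _).comp hval).congr' ?_
      filter_upwards [hmem] with n hn
      simp [F, Set.indicator_of_mem hn]
  refine hlim.congr' ?_
  filter_upwards [eventually_gt_atTop 0] with n hn using hFint n hn

/-! ### The mean-field equation and the potential -/

theorem hasDerivAt_tanh (x : ℝ) : HasDerivAt Real.tanh (1 - Real.tanh x ^ 2) x := by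
  have h := (Real.hasDerivAt_sinh x).div (Real.hasDerivAt_cosh x) (Real.cosh_pos x).ne'
  have e : Real.tanh = Real.sinh / Real.cosh := by
    funext y; exact Real.tanh_eq_sinh_div_cosh y
  rw [e]
  refine h.congr_deriv ?_
  have := (Real.cosh_pos x).ne'
  rw [Pi.div_apply]
  field_simp

theorem strictMono_tanh : StrictMono Real.tanh :=
  strictMono_of_hasDerivAt_pos hasDerivAt_tanh fun x => by
    have := Real.tanh_sq_lt_one x; linarith

theorem continuous_tanh : Continuous Real.tanh :=
  continuous_iff_continuousAt.2 fun x => (hasDerivAt_tanh x).continuousAt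

theorem tanh_lt_self {x : ℝ} (hx : 0 < x) : Real.tanh x < x := by
  have h : StrictMonoOn (fun y => y - Real.tanh y) (Set.Ici 0) := by
    refine strictMonoOn_of_deriv_pos (convex_Ici 0)
      (continuous_id.sub continuous_tanh).continuousOn fun y hy => ?_
    rw [interior_Ici] at hy
    have hd : deriv (fun y => y - Real.tanh y) y = 1 - (1 - Real.tanh y ^ 2) :=
      ((hasDerivAt_id y).sub (hasDerivAt_tanh y)).deriv
    rw [hd]
    have : 0 < Real.tanh y := by simpa using strictMono_tanh hy
    nlinarith
  have := h (Set.mem_Ici.2 le_rfl) (Set.mem_Ici.2 hx.le) hx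
  simp at this
  linarith

/-- Second order Taylor expansion at a critical point. -/
theorem tendsto_div_sq_of_hasDerivAt {F F' : ℝ → ℝ} {z c : ℝ} (hF : ∀ y, HasDerivAt F (F' y) y)
    (h0 : F' z = 0) (hF' : HasDerivAt F' c z) :
    Tendsto (fun t => (F (z + t) - F z) / t ^ 2) (𝓝[≠] 0) (𝓝 (c / 2)) := by
  refine HasDerivAt.lhopital_zero_nhdsNE (f' := fun t => F' (z + t)) (g' := fun t => 2 * t)
    ?_ ?_ ?_ ?_ ?_ ?_
  · exact Eventually.of_forall fun t => ((hF (z + t)).comp_const_add z t).sub_const _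
  · exact Eventually.of_forall fun t => by simpa using hasDerivAt_pow 2 t
  · filter_upwards [self_mem_nhdsWithin] with t ht using mul_ne_zero two_ne_zero ht
  · have : ContinuousAt (fun t => F (z + t) - F z) 0 :=
      (((hF (z + 0)).comp_const_add z 0).sub_const _).continuousAt
    simpa using this.tendsto.mono_left nhdsWithin_le_nhds
  · have : ContinuousAt (fun t : ℝ => t ^ 2) 0 := by fun_prop
    simpa using this.tendsto.mono_left nhdsWithin_le_nhds
  · have h1 := hasDerivAt_iff_tendsto_slope_zero.1 hF'
    refine (h1.div_const 2).congr fun t => ?_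
    simp only [h0, sub_zero, smul_eq_mul]
    rw [inv_mul_eq_div, div_div, mul_comm]

namespace CurieWeiss

theorem hasDerivAt_potential (a h y : ℝ) :
    HasDerivAt (potential a h) (a * (Real.tanh (a * y + h) - y)) y := by
  have hl : HasDerivAt (fun y : ℝ => a * y + h) a y := by
    simpa using ((hasDerivAt_id y).const_mul a).add_const h
  have h1 := (hl.cosh.log (Real.cosh_pos _).ne').sub
    (((hasDerivAt_pow 2 y).const_mul a).div_const 2)
  refine h1.congr_deriv ?_
  rw [Real.tanh_eq_sinh_div_cosh]
  simp
  ring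

theorem hasDerivAt_tanh_affine_sub (a h y : ℝ) :
    HasDerivAt (fun y => Real.tanh (a * y + h) - y)
      (a * (1 - Real.tanh (a * y + h) ^ 2) - 1) y := by
  have hl : HasDerivAt (fun y : ℝ => a * y + h) a y := by
    simpa using ((hasDerivAt_id y).const_mul a).add_const h
  refine (((hasDerivAt_tanh _).comp y hl).sub (hasDerivAt_id y)).congr_deriv ?_
  ring

theorem continuous_potential (a h : ℝ) : Continuous (potential a h) :=
  continuous_iff_continuousAt.2 fun y => (hasDerivAt_potential a h y).continuousAt

/-- `z` is the nonnegative point at which `tanh (a y + h) - y` changes sign from positive to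
negative as `y` runs over the positive half-line. -/
structure IsMeanFieldPoint (a h z : ℝ) : Prop where
  nonneg : 0 ≤ z
  eq_tanh : z = Real.tanh (a * z + h)
  lt_tanh : ∀ y, 0 < y → y < z → y < Real.tanh (a * y + h)
  tanh_lt : ∀ y, z < y → Real.tanh (a * y + h) < y

theorem IsMeanFieldPoint.lt_one {a h z : ℝ} (hz : IsMeanFieldPoint a h z) : z < 1 := by
  rw [hz.eq_tanh]; exact Real.tanh_lt_one _

theorem isMeanFieldPoint_of_zero {h : ℝ} (hh : 0 ≤ h) : IsMeanFieldPoint 0 h (Real.tanh h) where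
  nonneg := by simpa using strictMono_tanh.monotone hh
  eq_tanh := by simp
  lt_tanh y _ hy := by simpa using hy
  tanh_lt y hy := by simpa using hy

theorem isMeanFieldPoint_zero {a : ℝ} (ha1 : a ≤ 1) : IsMeanFieldPoint a 0 0 where
  nonneg := le_rfl
  eq_tanh := by simp
  lt_tanh y h1 h2 := (h1.not_gt h2).elim
  tanh_lt y hy := by
    rw [add_zero]
    exact (strictMono_tanh.monotone (mul_le_of_le_one_left hy.le ha1)).trans_lt (tanh_lt_self hy)

/-- With a positive field, or at low temperature, the mean-field equation has a unique positive
solution, because `tanh (a y + h) - y` is strictly concave on the positive half-line; concavity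
also makes it a nondegenerate critical point of the potential. -/
theorem exists_isMeanFieldPoint {a h : ℝ} (ha : 0 < a) (hh : 0 ≤ h) (hah : 0 < h ∨ 1 < a) :
    ∃ z, 0 < z ∧ a * (1 - z ^ 2) < 1 ∧ IsMeanFieldPoint a h z := by
  set g : ℝ → ℝ := fun y => Real.tanh (a * y + h) - y with hg
  have hgc : Continuous g := continuous_iff_continuousAt.2 fun y =>
    (hasDerivAt_tanh_affine_sub a h y).continuousAt
  have hanti : StrictAntiOn (fun y => a * (1 - Real.tanh (a * y + h) ^ 2) - 1) (Set.Ici 0) := by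
    intro x hx y hy hxy
    have h0 : 0 ≤ Real.tanh (a * x + h) := by
      have : 0 ≤ a * x + h := add_nonneg (mul_nonneg ha.le hx) hh
      simpa using strictMono_tanh.monotone this
    have h1 : Real.tanh (a * x + h) < Real.tanh (a * y + h) := strictMono_tanh (by nlinarith)
    have h2 : Real.tanh (a * x + h) ^ 2 < Real.tanh (a * y + h) ^ 2 :=
      pow_lt_pow_left₀ h1 h0 two_ne_zero
    simp only
    nlinarith
  have hconc : StrictConcaveOn ℝ (Set.Ici 0) g := by
    refine StrictAntiOn.strictConcaveOn_of_deriv (convex_Ici 0) hgc.continuousOn ?_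
    rw [interior_Ici]
    intro x hx y hy hxy
    rw [(hasDerivAt_tanh_affine_sub a h x).deriv, (hasDerivAt_tanh_affine_sub a h y).deriv]
    exact hanti (Set.mem_Ici.2 (le_of_lt hx)) (Set.mem_Ici.2 (le_of_lt hy)) hxy
  have hg0 : 0 ≤ g 0 := by
    simpa [hg] using strictMono_tanh.monotone hh
  obtain ⟨y₀, hy₀, hgy₀⟩ : ∃ y₀, 0 ≤ y₀ ∧ 0 < g y₀ := by
    rcases hah with hpos | ha1
    · exact ⟨0, le_rfl, by simpa [hg] using strictMono_tanh hpos⟩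
    · rcases hh.eq_or_lt with rfl | hpos
      · have h1 := hasDerivAt_iff_tendsto_slope_zero.1 (hasDerivAt_tanh_affine_sub a 0 0)
        simp only [mul_zero, add_zero, Real.tanh_zero, smul_eq_mul, zero_add, sub_zero] at h1
        have h2 := (h1.eventually (lt_mem_nhds (a := 0) (by norm_num; linarith))).filter_mono
          (nhdsWithin_mono 0 (s := Set.Ioi 0) (fun x (hx : 0 < x) => hx.ne'))
        obtain ⟨t, ht, ht0⟩ := (h2.and self_mem_nhdsWithin).exists
        have ht0' : 0 < t := ht0
        refine ⟨t, ht0'.le, ?_⟩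
        have := (pos_iff_pos_of_mul_pos ht).1 (by positivity)
        simpa [hg] using this
      · exact ⟨0, le_rfl, by simpa [hg] using strictMono_tanh hpos⟩
  have hg1 : ∀ y, 1 ≤ y → g y < 0 := fun y hy => by
    have := Real.tanh_lt_one (a * y + h)
    simp only [hg]; linarith
  have hy₀1 : y₀ ≤ 1 := by
    by_contra! hlt
    exact absurd (hg1 y₀ hlt.le) (not_lt.2 hgy₀.le)
  obtain ⟨z, ⟨hz1, hz2⟩, hgz⟩ := intermediate_value_Icc' hy₀1 hgc.continuousOn
    (show (0 : ℝ) ∈ Set.Icc (g 1) (g y₀) from ⟨(hg1 1 le_rfl).le, hgy₀.le⟩)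
  have hz0 : 0 < z := by
    refine lt_of_le_of_ne (hy₀.trans hz1) ?_
    rintro rfl
    have : y₀ = 0 := le_antisymm hz1 hy₀
    rw [this] at hgy₀
    linarith
  have hzt : z = Real.tanh (a * z + h) := by simp only [hg] at hgz; linarith
  refine ⟨z, hz0, ?_, hz0.le, hzt, fun y h1 h2 => ?_, fun y hy => ?_⟩
  · obtain ⟨c, hc, hce⟩ := exists_hasDerivAt_eq_slope g _ hz0 hgc.continuousOn
      fun x _ => hasDerivAt_tanh_affine_sub a h x
    have h1 := hanti (Set.mem_Ici.2 hc.1.le) (Set.mem_Ici.2 hz0.le) hc.2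
    simp only [hce] at h1
    rw [← hzt, hgz] at h1
    have h2 : (0 - g 0) / (z - 0) ≤ 0 := div_nonpos_of_nonpos_of_nonneg (by linarith) (by linarith)
    linarith
  · have h3 := hconc.lt_on_openSegment (Set.mem_Ici.2 le_rfl) (Set.mem_Ici.2 hz0.le) hz0.ne
      (z := y) (by rw [openSegment_eq_Ioo hz0]; exact ⟨h1, h2⟩)
    rw [hgz, min_eq_right hg0] at h3
    simp only [hg] at h3
    linarith
  · by_contra! hcon
    have hgy : 0 ≤ g y := by simp only [hg]; linarith
    have hy0 := hz0.trans hy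
    have h3 := hconc.lt_on_openSegment (Set.mem_Ici.2 le_rfl) (Set.mem_Ici.2 hy0.le) hy0.ne
      (z := z) (by rw [openSegment_eq_Ioo hy0]; exact ⟨hz0, hy⟩)
    rw [hgz] at h3
    exact absurd h3 (not_lt.2 (le_min hg0 hgy))

theorem IsMeanFieldPoint.abs_le_of_eq_tanh {a h z y : ℝ} (hz : IsMeanFieldPoint a h z)
    (hh : 0 ≤ h) (hy : y = Real.tanh (a * y + h)) : |y| ≤ z := by
  rw [abs_le']
  constructor
  · by_contra! hlt
    exact absurd hy (hz.tanh_lt y hlt).ne'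
  · by_contra! hlt
    have h1 := hz.tanh_lt (-y) hlt
    have h2 : Real.tanh (-(a * y + h)) ≤ Real.tanh (a * -y + h) :=
      strictMono_tanh.monotone (by linarith)
    rw [Real.tanh_neg, ← hy] at h2
    linarith

theorem IsMeanFieldPoint.potential_lt_of_nonneg {a h z y : ℝ} (hz : IsMeanFieldPoint a h z)
    (ha : 0 < a) (hy0 : 0 ≤ y) (hy : y ≠ z) : potential a h y < potential a h z := by
  rcases lt_or_gt_of_ne hy with hlt | hgt
  · have h1 : StrictMonoOn (potential a h) (Set.Icc 0 z) := by
      refine strictMonoOn_of_deriv_pos (convex_Icc 0 z) (continuous_potential a h).continuousOn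
        fun x hx => ?_
      rw [interior_Icc] at hx
      rw [(hasDerivAt_potential a h x).deriv]
      exact mul_pos ha (sub_pos.2 (hz.lt_tanh x hx.1 hx.2))
    exact h1 ⟨hy0, hlt.le⟩ ⟨hz.nonneg, le_rfl⟩ hlt
  · have h1 : StrictAntiOn (potential a h) (Set.Ici z) := by
      refine strictAntiOn_of_deriv_neg (convex_Ici z) (continuous_potential a h).continuousOn
        fun x hx => ?_
      rw [interior_Ici] at hx
      rw [(hasDerivAt_potential a h x).deriv]
      exact mul_neg_of_pos_of_neg ha (sub_neg.2 (hz.tanh_lt x hx))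
    exact h1 (Set.mem_Ici.2 le_rfl) (Set.mem_Ici.2 hgt.le) hgt

theorem potential_le_potential_abs {a h : ℝ} (ha : 0 ≤ a) (hh : 0 ≤ h) (y : ℝ) :
    potential a h y ≤ potential a h |y| := by
  have h1 : Real.cosh (a * y + h) ≤ Real.cosh (a * |y| + h) := by
    rw [Real.cosh_le_cosh, abs_of_nonneg (a := a * |y| + h) (by positivity)]
    refine (abs_add_le _ _).trans ?_
    rw [abs_mul, abs_of_nonneg ha, abs_of_nonneg hh]
  have h2 := Real.log_le_log (Real.cosh_pos _) h1
  rw [potential, potential, sq_abs]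
  linarith

theorem potential_lt_potential_abs {a h y : ℝ} (ha : 0 < a) (hh : 0 < h) (hy : y < 0) :
    potential a h y < potential a h |y| := by
  have h1 : Real.cosh (a * y + h) < Real.cosh (a * |y| + h) := by
    rw [Real.cosh_lt_cosh, abs_of_nonneg (a := a * |y| + h) (by positivity), abs_of_neg hy,
      abs_lt]
    constructor <;> nlinarith
  have h2 := Real.log_lt_log (Real.cosh_pos _) h1
  rw [potential, potential, sq_abs]
  linarith

theorem potential_zero_abs (a y : ℝ) : potential a 0 |y| = potential a 0 y := by
  rcases abs_choice y with h | h <;> simp [h, potential]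

theorem IsMeanFieldPoint.potential_le {a h z : ℝ} (hz : IsMeanFieldPoint a h z)
    (ha : 0 ≤ a) (hh : 0 ≤ h) (y : ℝ) : potential a h y ≤ potential a h z := by
  rcases ha.eq_or_lt with rfl | ha
  · simp [potential]
  · refine (potential_le_potential_abs ha.le hh y).trans ?_
    rcases eq_or_ne |y| z with h1 | h1
    · rw [h1]
    · exact (hz.potential_lt_of_nonneg ha (abs_nonneg y) h1).le

theorem IsMeanFieldPoint.potential_lt_of_pos_field {a h z : ℝ} (hz : IsMeanFieldPoint a h z)
    (ha : 0 < a) (hh : 0 < h) {y : ℝ} (hy : y ≠ z) : potential a h y < potential a h z := by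
  rcases le_or_gt 0 y with h0 | h0
  · exact hz.potential_lt_of_nonneg ha h0 hy
  · exact (potential_lt_potential_abs ha hh h0).trans_le (hz.potential_le ha.le hh.le _)

theorem potential_lt_of_le_one {a : ℝ} (ha : 0 < a) (ha1 : a ≤ 1) {y : ℝ} (hy : y ≠ 0) :
    potential a 0 y < potential a 0 0 := by
  rw [← potential_zero_abs]
  exact (isMeanFieldPoint_zero ha1).potential_lt_of_nonneg ha (abs_nonneg y) (by simpa using hy)

/-- Quadratic decay of the potential at infinity. -/
theorem exists_potential_sub_le {a : ℝ} (ha : 0 < a) (h z : ℝ) :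
    ∃ R, ∀ y, R ≤ |y - z| → potential a h y - potential a h z ≤ -(a / 4) * (y - z) ^ 2 := by
  have hlog : ∀ u, Real.log (Real.cosh u) ≤ |u| := by
    intro u
    rw [Real.log_le_iff_le_exp (Real.cosh_pos u), ← Real.cosh_abs, Real.cosh_eq]
    have : Real.exp (-|u|) ≤ Real.exp |u| :=
      Real.exp_le_exp.2 (by linarith [abs_nonneg u])
    linarith
  set B := a + a * |z| with hB
  set C := a * |z| + |h| + |potential a h z| with hC
  have hB0 : 0 ≤ B := by positivity
  have hC0 : 0 ≤ C := by positivity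
  refine ⟨max 1 (4 * (B + C) / a), fun y hy => ?_⟩
  have h1 : 1 ≤ |y - z| := (le_max_left _ _).trans hy
  have h2 : 4 * (B + C) ≤ |y - z| * a := (div_le_iff₀ ha).1 ((le_max_right _ _).trans hy)
  have h3 : Real.log (Real.cosh (a * y + h)) ≤ a * |y - z| + a * |z| + |h| := by
    refine (hlog _).trans ((abs_add_le _ _).trans ?_)
    rw [abs_mul, abs_of_pos ha]
    have : |y| ≤ |y - z| + |z| := by simpa using abs_add_le (y - z) z
    nlinarith
  have h4 : -|potential a h z| ≤ potential a h z := neg_abs_le _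
  have h5 : a * (y - z) ^ 2 / 2 - a * |z| * |y - z| ≤ a * y ^ 2 / 2 := by
    have h6 : -(|y - z| * |z|) ≤ (y - z) * z := by
      rw [← abs_mul]; exact neg_abs_le _
    nlinarith [sq_nonneg z]
  have h7 : B * |y - z| + C ≤ a / 4 * |y - z| ^ 2 := by nlinarith
  rw [sq_abs] at h7
  have h8 : potential a h y = Real.log (Real.cosh (a * y + h)) - a * y ^ 2 / 2 := rfl
  rw [h8]
  nlinarith

theorem tendsto_potential_div_sq {a h z : ℝ} (hz : z = Real.tanh (a * z + h)) :
    Tendsto (fun t => (potential a h (z + t) - potential a h z) / t ^ 2) (𝓝[≠] 0)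
      (𝓝 (-(a * (1 - a * (1 - z ^ 2)) / 2))) := by
  have := tendsto_div_sq_of_hasDerivAt (hasDerivAt_potential a h) (z := z)
    (by rw [← hz]; simp) ((hasDerivAt_tanh_affine_sub a h z).const_mul a)
  convert this using 2
  rw [← hz]; ring

/-- At the critical point, `log cosh t - t² / 2 ~ -t⁴ / 12`. -/
theorem tendsto_potential_div_pow_four :
    Tendsto (fun t => (potential 1 0 (0 + t) - potential 1 0 0) / t ^ 4) (𝓝[≠] 0)
      (𝓝 (-(1 / 12))) := by
  have htanh : Tendsto (fun t => Real.tanh t / t) (𝓝[≠] 0) (𝓝 1) := by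
    have := hasDerivAt_iff_tendsto_slope_zero.1 (hasDerivAt_tanh 0)
    simp only [zero_add, Real.tanh_zero, sub_zero, smul_eq_mul] at this
    convert this using 2
    · rw [div_eq_inv_mul]
    · norm_num
  have hcub : Tendsto (fun t => (Real.tanh t - t) / (4 * t ^ 3)) (𝓝[≠] 0) (𝓝 (-(1 / 12))) := by
    refine HasDerivAt.lhopital_zero_nhdsNE (f' := fun t => 1 - Real.tanh t ^ 2 - 1)
      (g' := fun t => 4 * (3 * t ^ 2)) ?_ ?_ ?_ ?_ ?_ ?_
    · exact Eventually.of_forall fun t => (hasDerivAt_tanh t).sub (hasDerivAt_id t)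
    · exact Eventually.of_forall fun t => by simpa using (hasDerivAt_pow 3 t).const_mul 4
    · filter_upwards [self_mem_nhdsWithin] with t ht
      have : t ≠ 0 := ht
      positivity
    · have : ContinuousAt (fun t => Real.tanh t - t) 0 :=
        (continuous_tanh.sub continuous_id).continuousAt
      simpa using this.tendsto.mono_left nhdsWithin_le_nhds
    · have : ContinuousAt (fun t : ℝ => 4 * t ^ 3) 0 := by fun_prop
      simpa using this.tendsto.mono_left nhdsWithin_le_nhds
    · have h1 := ((htanh.pow 2).div_const 12).neg
      rw [one_pow] at h1
      refine h1.congr' ?_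
      filter_upwards [self_mem_nhdsWithin] with t ht
      have : t ≠ 0 := ht
      field_simp
      ring
  refine HasDerivAt.lhopital_zero_nhdsNE (f' := fun t => Real.tanh t - t)
    (g' := fun t => 4 * t ^ 3) ?_ ?_ ?_ ?_ ?_ hcub
  · refine Eventually.of_forall fun t => ?_
    simpa using (hasDerivAt_potential 1 0 t).sub_const (potential 1 0 0)
  · exact Eventually.of_forall fun t => by simpa using hasDerivAt_pow 4 t
  · filter_upwards [self_mem_nhdsWithin] with t ht
    have : t ≠ 0 := ht
    positivity
  · have : ContinuousAt (fun t => potential 1 0 (0 + t) - potential 1 0 0) 0 := by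
      have := continuous_potential 1 0
      fun_prop
    simpa using this.tendsto.mono_left nhdsWithin_le_nhds
  · have : ContinuousAt (fun t : ℝ => t ^ 4) 0 := by fun_prop
    simpa using this.tendsto.mono_left nhdsWithin_le_nhds

end CurieWeiss

/-! ### Asymptotics of the concentration function -/

namespace CurieWeiss

theorem levelWeight_neg_field (a h : ℝ) {n k : ℕ} (hk : k ≤ n) :
    levelWeight a (-h) n k = levelWeight a h n (n - k) := by
  rw [levelWeight, levelWeight, Nat.choose_symm hk, Nat.cast_sub hk]
  ring_nf

/-- Flipping all spins changes the sign of the field. -/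
theorem peakWeight_neg_field (a h : ℝ) (n : ℕ) : peakWeight a (-h) n = peakWeight a h n := by
  have key : ∀ h, peakWeight a (-h) n ≤ peakWeight a h n := fun h => by
    refine sup'_le _ _ fun k hk => ?_
    rw [levelWeight_neg_field a h (Nat.lt_succ_iff.1 (mem_range.1 hk))]
    exact levelWeight_le_peakWeight a h (Nat.sub_le n k)
  exact le_antisymm (key h) (by simpa using key (-h))

theorem levelSum_neg_field (a h : ℝ) (n : ℕ) : levelSum a (-h) n = levelSum a h n := by
  rw [levelSum, levelSum, ← sum_range_reflect]
  refine sum_congr rfl fun k hk => ?_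
  have hk : k ≤ n := Nat.lt_succ_iff.1 (mem_range.1 hk)
  rw [levelWeight_neg_field _ _ (by omega)]
  congr 1
  omega

theorem Qplus_eq_abs_field (d : ℕ) (β h : ℝ) (n : ℕ) :
    Qplus d β h n = peakWeight (2 * d * β) |h| n / levelSum (2 * d * β) |h| n := by
  rw [Qplus_eq]
  rcases abs_choice h with e | e
  · rw [e]
  · rw [e, peakWeight_neg_field, levelSum_neg_field]

/-- The normalizing constant divided by its exponential order of growth. -/
noncomputable def scaledLevelSum (a h z : ℝ) (n : ℕ) : ℝ :=
  levelSum a h n * Real.exp (-(n * (Real.log 2 + potential a h z)))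

theorem scaledLevelSum_eq_integral {a : ℝ} (ha : 0 < a) (h z : ℝ) {n : ℕ} (hn : 0 < n) :
    scaledLevelSum a h z n = √(a / (2 * Real.pi)) *
      (√n * ∫ y, Real.exp (n * (potential a h y - potential a h z))) := by
  have e : ∀ y, Real.exp (n * (potential a h y - potential a h z)) =
      Real.exp (-(n * potential a h z)) * Real.exp (n * potential a h y) := fun y => by
    rw [← Real.exp_add]; ring_nf
  have e2 : Real.exp (-(n * (Real.log 2 + potential a h z))) =
      (2 ^ n)⁻¹ * Real.exp (-(n * potential a h z)) := by
    rw [mul_add, neg_add, Real.exp_add, Real.exp_neg, Real.exp_nat_mul, Real.exp_log two_pos]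
  simp only [e]
  rw [MeasureTheory.integral_const_mul, scaledLevelSum, levelSum_eq_integral ha h hn, e2,
    show n * a / (2 * Real.pi) = a / (2 * Real.pi) * n by ring,
    Real.sqrt_mul (by have := Real.pi_pos; positivity)]
  field_simp

theorem tendsto_integral_potential {a h z : ℝ} {D : Set ℝ} (ha : 0 < a)
    (hz : z = Real.tanh (a * z + h)) (hcurv : a * (1 - z ^ 2) < 1) (hD : IsClosed D)
    (hDz : D ∈ 𝓝 z) (hlt : ∀ y ∈ D, y ≠ z → potential a h y < potential a h z) :
    Tendsto (fun n : ℕ => √(a / (2 * Real.pi)) *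
      (√n * ∫ y in D, Real.exp (n * (potential a h y - potential a h z)))) atTop
      (𝓝 (√(1 - a * (1 - z ^ 2)))⁻¹) := by
  obtain ⟨R, hR⟩ := exists_potential_sub_le ha h z
  have hκ : 0 < a * (1 - a * (1 - z ^ 2)) / 2 := by
    have : 0 < 1 - a * (1 - z ^ 2) := by linarith
    positivity
  have hlap := tendsto_laplace (f := fun y => potential a h y - potential a h z) (D := D)
    (m := 2) even_two le_rfl ((continuous_potential a h).sub continuous_const) hD hDz (sub_self _)
    hκ (tendsto_potential_div_sq hz) (fun y hy hyz => sub_neg.2 (hlt y hy hyz))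
    (by positivity : 0 < a / 4) (fun y _ => hR y)
  rw [integral_gaussian] at hlap
  have := hlap.const_mul √(a / (2 * Real.pi))
  convert this using 2
  · rw [Real.sqrt_eq_rpow (_ : ℝ)]; norm_num [Real.sqrt_eq_rpow]
  · rw [← Real.sqrt_mul (by have := Real.pi_pos; positivity), ← Real.sqrt_inv]
    congr 1
    have : 1 - a * (1 - z ^ 2) ≠ 0 := by linarith
    field_simp

theorem tendsto_scaledLevelSum_of_unique {a h z : ℝ} (ha : 0 < a)
    (hz : z = Real.tanh (a * z + h)) (hcurv : a * (1 - z ^ 2) < 1)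
    (hlt : ∀ y, y ≠ z → potential a h y < potential a h z) :
    Tendsto (scaledLevelSum a h z) atTop (𝓝 (√(1 - a * (1 - z ^ 2)))⁻¹) := by
  refine (tendsto_integral_potential ha hz hcurv isClosed_univ univ_mem
    fun y _ => hlt y).congr' ?_
  filter_upwards [eventually_gt_atTop 0] with n hn
  rw [scaledLevelSum_eq_integral ha h z hn, MeasureTheory.setIntegral_univ]

/-- At low temperature without field, the two maxima `z` and `-z` of the potential contribute
equally. -/
theorem tendsto_scaledLevelSum_of_two {a z : ℝ} (ha : 0 < a) (hz0 : 0 < z)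
    (hz : IsMeanFieldPoint a 0 z) (hcurv : a * (1 - z ^ 2) < 1) :
    Tendsto (scaledLevelSum a 0 z) atTop (𝓝 (2 * (√(1 - a * (1 - z ^ 2)))⁻¹)) := by
  refine ((tendsto_integral_potential ha hz.eq_tanh hcurv isClosed_Ici (Ici_mem_nhds hz0)
    fun y hy => hz.potential_lt_of_nonneg ha hy).const_mul 2).congr' ?_
  filter_upwards [eventually_gt_atTop 0] with n hn
  have := integral_comp_abs (f := fun y => Real.exp (n * (potential a 0 y - potential a 0 z)))
  simp only [potential_zero_abs] at this
  rw [scaledLevelSum_eq_integral ha 0 z hn, this, MeasureTheory.integral_Ici_eq_integral_Ioi]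
  ring

theorem tendsto_scaledLevelSum_of_zero (h z : ℝ) :
    Tendsto (scaledLevelSum 0 h z) atTop (𝓝 (√(1 - 0 * (1 - z ^ 2)))⁻¹) := by
  refine tendsto_const_nhds.congr fun n => ?_
  rw [scaledLevelSum, levelSum_of_zero, ← Real.exp_add]
  simp [potential]

theorem integral_exp_neg_pow_four : ∫ x : ℝ, Real.exp (-(1 / 12) * x ^ 4) =
    (12 : ℝ) ^ (1 / 4 : ℝ) * Real.Gamma (1 / 4) / 2 := by
  have h1 := integral_comp_abs (f := fun x => Real.exp (-(1 / 12) * x ^ (4 : ℝ)))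
  have h2 : ∀ x : ℝ, |x| ^ (4 : ℝ) = x ^ 4 := fun x => by
    rw [show (4 : ℝ) = ((4 : ℕ) : ℝ) by norm_num, Real.rpow_natCast, Even.pow_abs (by decide)]
  simp only [h2] at h1
  rw [h1, integral_exp_neg_mul_rpow (by norm_num) (by norm_num),
    Real.Gamma_add_one (by norm_num), one_div (12 : ℝ), Real.inv_rpow (by norm_num),
    ← Real.rpow_neg (by norm_num)]
  norm_num
  ring

theorem tendsto_scaledLevelSum_critical :
    Tendsto (fun n : ℕ => (n : ℝ) ^ (-(1 / 4) : ℝ) * scaledLevelSum 1 0 0 n) atTop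
      (𝓝 (√(1 / (2 * Real.pi)) * ((12 : ℝ) ^ (1 / 4 : ℝ) * Real.Gamma (1 / 4) / 2))) := by
  obtain ⟨R, hR⟩ := exists_potential_sub_le one_pos 0 0
  have hlap := tendsto_laplace (f := fun y => potential 1 0 y - potential 1 0 0) (D := Set.univ)
    (m := 4) (κ := 1 / 12) (by decide) (by norm_num)
    ((continuous_potential 1 0).sub continuous_const) isClosed_univ univ_mem (sub_self _)
    (by norm_num) tendsto_potential_div_pow_four
    (fun y _ hy => sub_neg.2 (potential_lt_of_le_one one_pos le_rfl hy))
    (by norm_num : (0 : ℝ) < 1 / 4) (fun y _ => hR y)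
  rw [integral_exp_neg_pow_four] at hlap
  refine (hlap.const_mul √(1 / (2 * Real.pi))).congr' ?_
  filter_upwards [eventually_gt_atTop 0] with n hn
  have hn' : (0 : ℝ) < n := by exact_mod_cast hn
  rw [scaledLevelSum_eq_integral one_pos 0 0 hn, MeasureTheory.setIntegral_univ, Nat.cast_ofNat,
    Real.sqrt_eq_rpow (n : ℝ), mul_left_comm ((n : ℝ) ^ (-(1 / 4) : ℝ)),
    ← mul_assoc ((n : ℝ) ^ (-(1 / 4) : ℝ)), ← Real.rpow_add hn']
  norm_num

theorem isEquivalent_of_tendsto_mul_rpow {u : ℕ → ℝ} {r L : ℝ} (hL : L ≠ 0)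
    (hu : Tendsto (fun n : ℕ => (n : ℝ) ^ r * u n) atTop (𝓝 L)) :
    Asymptotics.IsEquivalent atTop u (fun n : ℕ => L * (n : ℝ) ^ (-r)) := by
  refine Asymptotics.isEquivalent_of_tendsto_one ?_
  have h := hu.div_const L
  rw [div_self hL] at h
  refine h.congr' ?_
  filter_upwards [eventually_gt_atTop 0] with n hn
  have hn' : (0 : ℝ) < n := by exact_mod_cast hn
  have := (Real.rpow_pos_of_pos hn' r).ne'
  simp only [Pi.div_apply]
  rw [Real.rpow_neg hn'.le]
  field_simp

theorem IsMeanFieldPoint.tendsto_peakWeight {a h z : ℝ} (hz : IsMeanFieldPoint a h z)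
    (ha : 0 ≤ a) (hh : 0 ≤ h) :
    Tendsto (fun n : ℕ => √n * (peakWeight a h n *
      Real.exp (-(n * (Real.log 2 + potential a h z))))) atTop
      (𝓝 √(2 / (Real.pi * (1 - z ^ 2)))) := by
  have := CurieWeiss.tendsto_peakWeight hz.nonneg hz.eq_tanh
    (fun y hy => hz.abs_le_of_eq_tanh hh hy) (hz.potential_le ha hh)
  simpa only [mul_assoc] using this

theorem peakWeight_div_levelSum (a h z : ℝ) (n : ℕ) :
    peakWeight a h n / levelSum a h n = peakWeight a h n *
      Real.exp (-(n * (Real.log 2 + potential a h z))) / scaledLevelSum a h z n := by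
  rw [scaledLevelSum, mul_div_mul_right _ _ (Real.exp_ne_zero _)]

/-- The noncritical regimes: `c` is the number of maxima of the free energy. -/
theorem isEquivalent_Qplus_of_tendsto {d : ℕ} {β h z c : ℝ} (ha : 0 ≤ 2 * d * β)
    (hz : IsMeanFieldPoint (2 * d * β) |h| z) (hcurv : 2 * d * β * (1 - z ^ 2) < 1) (hc : 0 < c)
    (hZ : Tendsto (scaledLevelSum (2 * d * β) |h| z) atTop
      (𝓝 (c * (√(1 - 2 * d * β * (1 - z ^ 2)))⁻¹))) :
    Asymptotics.IsEquivalent atTop (fun n : ℕ => Qplus d β h n)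
      (fun n : ℕ => √(2 * (1 / (1 - z ^ 2) - 2 * d * β) / (c ^ 2 * Real.pi)) *
        (n : ℝ) ^ (-(1 / 2) : ℝ)) := by
  have hz2 : 0 < 1 - z ^ 2 := by nlinarith [hz.nonneg, hz.lt_one]
  have hcurv' : 0 < 1 - 2 * d * β * (1 - z ^ 2) := by linarith
  have hpi := Real.pi_pos
  have hpos : 0 < 1 / (1 - z ^ 2) - 2 * d * β := by
    rw [sub_pos, lt_div_iff₀ hz2]; exact hcurv
  refine isEquivalent_of_tendsto_mul_rpow (by positivity) ?_
  have h1 := (hz.tendsto_peakWeight ha (abs_nonneg h)).div hZ (by positivity)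
  have hval : √(2 / (Real.pi * (1 - z ^ 2))) / (c * (√(1 - 2 * d * β * (1 - z ^ 2)))⁻¹) =
      √(2 * (1 / (1 - z ^ 2) - 2 * d * β) / (c ^ 2 * Real.pi)) := by
    rw [show 2 * (1 / (1 - z ^ 2) - 2 * d * β) / (c ^ 2 * Real.pi) =
      2 / (Real.pi * (1 - z ^ 2)) * (1 - 2 * d * β * (1 - z ^ 2)) / c ^ 2 by field_simp,
      Real.sqrt_div (by positivity : 0 ≤ 2 / (Real.pi * (1 - z ^ 2)) *
        (1 - 2 * d * β * (1 - z ^ 2))),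
      Real.sqrt_mul (by positivity : 0 ≤ 2 / (Real.pi * (1 - z ^ 2))), Real.sqrt_sq hc.le]
    field_simp
  rw [hval] at h1
  refine h1.congr fun n => ?_
  rw [Qplus_eq_abs_field, peakWeight_div_levelSum _ _ z, ← Real.sqrt_eq_rpow, Pi.div_apply,
    mul_div_assoc]

theorem isEquivalent_Qplus_critical {d : ℕ} {β : ℝ} (ha : 2 * d * β = 1) :
    Asymptotics.IsEquivalent atTop (fun n : ℕ => Qplus d β 0 n)
      (fun n : ℕ => 2 / ((3 / 4 : ℝ) ^ (1 / 4 : ℝ) * Real.Gamma (1 / 4)) *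
        (n : ℝ) ^ (-(3 / 4) : ℝ)) := by
  have hΓ : 0 < Real.Gamma (1 / 4) := Real.Gamma_pos_of_pos (by norm_num)
  have hpi := Real.pi_pos
  refine isEquivalent_of_tendsto_mul_rpow (by positivity) ?_
  have h1 := ((isMeanFieldPoint_zero le_rfl).tendsto_peakWeight zero_le_one le_rfl).div
    tendsto_scaledLevelSum_critical (by positivity)
  have hval : √(2 / (Real.pi * (1 - 0 ^ 2))) /
      (√(1 / (2 * Real.pi)) * ((12 : ℝ) ^ (1 / 4 : ℝ) * Real.Gamma (1 / 4) / 2)) =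
      2 / ((3 / 4 : ℝ) ^ (1 / 4 : ℝ) * Real.Gamma (1 / 4)) := by
    have e1 : √(2 / (Real.pi * (1 - 0 ^ 2))) = 2 * √(1 / (2 * Real.pi)) := by
      rw [show 2 / (Real.pi * (1 - 0 ^ 2)) = 2 ^ 2 * (1 / (2 * Real.pi)) by field_simp; norm_num,
        Real.sqrt_mul (by positivity), Real.sqrt_sq two_pos.le]
    have e2 : (12 : ℝ) ^ (1 / 4 : ℝ) = 2 * (3 / 4 : ℝ) ^ (1 / 4 : ℝ) := by
      rw [show (12 : ℝ) = 2 ^ (4 : ℝ) * (3 / 4) by norm_num,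
        Real.mul_rpow (by positivity) (by positivity), ← Real.rpow_mul two_pos.le]
      norm_num
    rw [e1, e2]
    have : √(1 / (2 * Real.pi)) ≠ 0 := by positivity
    field_simp
  rw [hval] at h1
  refine h1.congr' ?_
  filter_upwards [eventually_gt_atTop 0] with n hn
  have hn' : (0 : ℝ) < n := by exact_mod_cast hn
  rw [Qplus_eq_abs_field, ha, abs_zero, peakWeight_div_levelSum _ _ 0, Pi.div_apply,
    Real.sqrt_eq_rpow, mul_div_mul_comm, ← Real.rpow_sub hn']
  norm_num

theorem meanFieldSolutions_eq {d : ℕ} (β h : ℝ) :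
    meanFieldSolutions d β h = {z | z = Real.tanh (2 * d * β * z + |h|)} := by
  rw [meanFieldSolutions, betaC]
  ext z
  rw [Set.mem_ofPred_eq, Set.mem_ofPred_eq, div_div_eq_mul_div, div_one, mul_comm β]

theorem IsMeanFieldPoint.isGreatest {d : ℕ} {β h z : ℝ}
    (hz : IsMeanFieldPoint (2 * d * β) |h| z) : IsGreatest (meanFieldSolutions d β h) z := by
  rw [meanFieldSolutions_eq]
  exact ⟨hz.eq_tanh, fun y hy => (le_abs_self y).trans
    (hz.abs_le_of_eq_tanh (abs_nonneg h) hy)⟩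

end CurieWeiss

open CurieWeiss in
theorem theorem1p3 (d : ℕ) (hd : 0 < d) (β : ℝ) (hβ : 0 ≤ β) (h : ℝ) :
    (h = 0 → β < CurieWeiss.betaC d →
      Asymptotics.IsEquivalent Filter.atTop (fun n : ℕ => CurieWeiss.Qplus d β h n)
        (fun n : ℕ => Real.sqrt (2 * (1 - 2 * (d : ℝ) * β) / Real.pi)
          * (n : ℝ) ^ (-(1 / 2) : ℝ))) ∧
    (h = 0 → β = CurieWeiss.betaC d →
      Asymptotics.IsEquivalent Filter.atTop (fun n : ℕ => CurieWeiss.Qplus d β h n)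
        (fun n : ℕ => 2 / ((3 / 4 : ℝ) ^ (1 / 4 : ℝ) * Real.Gamma (1 / 4))
          * (n : ℝ) ^ (-(3 / 4) : ℝ))) ∧
    (h = 0 → CurieWeiss.betaC d < β →
      ∃ z : ℝ, IsGreatest (CurieWeiss.meanFieldSolutions d β h) z ∧
        Asymptotics.IsEquivalent Filter.atTop (fun n : ℕ => CurieWeiss.Qplus d β h n)
          (fun n : ℕ => Real.sqrt ((1 / (1 - z ^ 2) - 2 * (d : ℝ) * β) / (2 * Real.pi))
            * (n : ℝ) ^ (-(1 / 2) : ℝ))) ∧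
    (h ≠ 0 →
      ∃ z : ℝ, IsGreatest (CurieWeiss.meanFieldSolutions d β h) z ∧
        Asymptotics.IsEquivalent Filter.atTop (fun n : ℕ => CurieWeiss.Qplus d β h n)
          (fun n : ℕ => Real.sqrt (2 * (1 / (1 - z ^ 2) - 2 * (d : ℝ) * β) / Real.pi)
            * (n : ℝ) ^ (-(1 / 2) : ℝ))) := by
  have hd' : (0 : ℝ) < 2 * d := by positivity
  have ha : 0 ≤ 2 * d * β := by positivity
  refine ⟨?_, ?_, ?_, ?_⟩
  · rintro rfl hlt
    have ha1 : 2 * d * β < 1 := by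
      rw [betaC, lt_div_iff₀ hd'] at hlt; linarith
    have hz := isMeanFieldPoint_zero ha1.le
    have hcurv : 2 * d * β * (1 - 0 ^ 2) < 1 := by simpa using ha1
    have hZ : Tendsto (scaledLevelSum (2 * d * β) 0 0) atTop
        (𝓝 (√(1 - 2 * d * β * (1 - 0 ^ 2)))⁻¹) := by
      rcases ha.eq_or_lt with h0 | hpos
      · rw [← h0]; exact tendsto_scaledLevelSum_of_zero 0 0
      · exact tendsto_scaledLevelSum_of_unique hpos hz.eq_tanh hcurv
          fun y hy => potential_lt_of_le_one hpos ha1.le hy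
    have := isEquivalent_Qplus_of_tendsto (d := d) (β := β) (h := 0) (c := 1) ha
      (by simpa using hz) hcurv one_pos (by simpa using hZ)
    simpa using this
  · rintro rfl heq
    refine isEquivalent_Qplus_critical ?_
    rw [heq, betaC]
    field_simp
  · rintro rfl hgt
    have ha1 : 1 < 2 * d * β := by
      rw [betaC, div_lt_iff₀ hd'] at hgt; linarith
    obtain ⟨z, hz0, hcurv, hz⟩ := exists_isMeanFieldPoint (by linarith) le_rfl (Or.inr ha1)
    have hz' : IsMeanFieldPoint (2 * d * β) |0| z := by simpa using hz
    refine ⟨z, hz'.isGreatest, ?_⟩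
    have := isEquivalent_Qplus_of_tendsto (d := d) (β := β) (h := 0) (c := 2) ha hz' hcurv
      two_pos (by simpa using tendsto_scaledLevelSum_of_two (by linarith) hz0 hz hcurv)
    convert this using 4
    field_simp
  · intro hh
    have hh' : 0 < |h| := abs_pos.2 hh
    rcases ha.eq_or_lt with h0 | hpos
    · have hz := isMeanFieldPoint_of_zero hh'.le
      rw [h0] at hz
      refine ⟨_, hz.isGreatest, ?_⟩
      have := isEquivalent_Qplus_of_tendsto (c := 1) ha hz (by rw [← h0]; simp) one_pos (by
        rw [one_mul, ← h0]; exact tendsto_scaledLevelSum_of_zero _ _)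
      simpa using this
    · obtain ⟨z, hz0, hcurv, hz⟩ := exists_isMeanFieldPoint hpos hh'.le (Or.inl hh')
      refine ⟨z, hz.isGreatest, ?_⟩
      have := isEquivalent_Qplus_of_tendsto (c := 1) ha hz hcurv one_pos (by
        rw [one_mul]
        exact tendsto_scaledLevelSum_of_unique hpos hz.eq_tanh hcurv
          fun y hy => hz.potential_lt_of_pos_field hpos hh' hy)
      simpa using this
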